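/- Consider a sequence of models whose dimension $p$ tends to infinity; all objects below may depend on the model in the sequence, unless they are called constants. For each model let $\mathbf W_0=\mathbf I_p,\mathbf W_1,\dots,\mathbf W_K\in\mathbb R^{p\times p}$ be symmetric (non-random) matrices, let $\beta^{(0)}\in\mathbb R^{K+1}$ have support $\mathcal S=\{k:\beta^{(0)}_k\neq0\}$ with $|\mathcal S|=s+1>0$ ($K$ and $s$ may be fixed or diverge), and put $\Sigma(\beta)=\sum_{k=0}^K\beta_k\mathbf W_k$, $\Sigma_0=\Sigma(\beta^{(0)})$. The observation is a random vector $\mathbf y\in\mathbb R^p$, the loss is $Q(\beta)=\frac1{2p}\|\mathbf y\mathbf y^\top-\Sigma(\beta)\|_F^2$, and the oracle estimator $\hat\beta^{\rm oracle}$ is the minimizer of $Q$ over all $\beta\in\mathbb R^{K+1}$ with $\beta_k=0$ for $k\notin\mathcal S$. Write $\|M\|_1$ for the maximal absolute column sum, $\|M\|$ for the spectral norm, $\|M\|_F$ for the Frobenius norm and $\circ$ for the entrywise product of matrices. Assume that there are positive constants $\tau_{\min},c,\sigma_{\min},w,\sigma_{\max},\tau_0$ and a constant $\mu_4$ such that,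 for all models of the sequence: (C2) $\lambda_{\min}\big(p^{-1}\{\mathrm{tr}(\mathbf W_k\mathbf W_l)\}_{k,l\in\mathcal S}\big)\ge\tau_{\min}$. (C3) $\mathbf y=\Sigma_0^{1/2}\mathbf Z$, where $\mathbf Z=(Z_1,\dots,Z_p)^\top$ has independent, identically distributed entries with $E Z_j=0$, $\mathrm{var}(Z_j)=1$, $E Z_j^4=\mu_4$ and $E e^{tZ_j}\le e^{c^2t^2/2}$ for all $t\in\mathbb R$; and $\lambda_{\min}(\Sigma_0)\ge\sigma_{\min}$. (C4) $\|\mathbf W_k\|_1\le w$ for $0\le k\le K$, and $\|\Sigma_0^{1/2}\|_1\le\sigma_{\max}^{1/2}$. (C6) There are positive definite matrices $\mathbf G_0,\mathbf G_1\in\mathbb R^{(s+1)\times(s+1)}$ and a matrix $\mathbf H\in\mathbb R^{(s+1)\times(s+1)}$ with $\lambda_{\min}(\mathbf G_d)\ge\tau_0$ for $d=0,1$, such that, as $p\to\infty$, $$\Big\|p^{-1}\{\mathrm{tr}(\Sigma_0^d\mathbf W_k\Sigma_0^d\mathbf W_l)\}_{k,l\in\mathcal S}-\mathbf G_d\Big\|_F\to0\quad(d=0,1),$$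 $$\Big\|p^{-1}\{\mathrm{tr}[(\Sigma_0^{1/2}\mathbf W_k\Sigma_0^{1/2})\circ(\Sigma_0^{1/2}\mathbf W_l\Sigma_0^{1/2})]\}_{k,l\in\mathcal S}-\mathbf H\Big\|_F\to0 .$$ Let $L>0$ be a fixed integer, let $\mathbf A\in\mathbb R^{L\times(s+1)}$ be matrices with $\sup\|\mathbf A\|<\infty$, and let $\mathbf C\in\mathbb R^{L\times L}$ be a positive definite matrix such that $$(s+1)^{-1}\mathbf A\{2\mathbf G_1+(\mu_4-3)\mathbf H\}\mathbf A^\top\to\mathbf C\qquad\text{as }p\to\infty$$ (if $s$, $\mathbf A$, $\mathbf G_1$ and $\mathbf H$ do not change along the sequence, this says that $\mathbf C$ equals the left-hand side). Then $$\sqrt{p/(s+1)}\;\mathbf A\mathbf G_0\big(\hat\beta^{\rm oracle}_{\mathcal S}-\beta^{(0)}_{\mathcal S}\big)\to_d\mathcal N(\mathbf 0,\mathbf C)\qquad\text{as }p\to\infty .$$ -/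

import Mathlib

open Filter MeasureTheory ProbabilityTheory
open scoped NNReal Topology

namespace SCR

noncomputable section

/-- The index set `𝒮 = supp(β)` of the nonzero coefficients. -/
abbrev Supp {K : ℕ} (β : Fin (K + 1) → ℝ) : Type := {k : Fin (K + 1) // β k ≠ 0}

/-- The covariance matrix `Σ(β) = ∑ₖ βₖ Wₖ`. -/
def cov {p K : ℕ} (W : Fin (K + 1) → Matrix (Fin p) (Fin p) ℝ) (β : Fin (K + 1) → ℝ) :
    Matrix (Fin p) (Fin p) ℝ :=
  ∑ k, β k • W k

open scoped MatrixOrder in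
/-- The positive semidefinite square root `Σ(β)^{1/2}`. -/
def covSqrt {p K : ℕ} (W : Fin (K + 1) → Matrix (Fin p) (Fin p) ℝ) (β : Fin (K + 1) → ℝ) :
    Matrix (Fin p) (Fin p) ℝ :=
  CFC.sqrt (cov W β)

/-- The Frobenius norm. -/
def frobNorm {m n : Type*} [Fintype m] [Fintype n] (M : Matrix m n ℝ) : ℝ :=
  √(∑ i, ∑ j, M i j ^ 2)

open scoped Matrix.Norms.L2Operator in
/-- The spectral norm `‖M‖ = λ_max(Mᵀ M)^{1/2}`. -/
def opNorm {m n : Type*} [Fintype m] [Fintype n] [DecidableEq n] (M : Matrix m n ℝ) : ℝ :=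
  ‖M‖

/-- `‖M‖₁ ≤ c`, where `‖M‖₁` is the maximal absolute column sum. -/
def OneNormLE {m n : Type*} [Fintype m] (M : Matrix m n ℝ) (c : ℝ) : Prop :=
  ∀ j, ∑ i, |M i j| ≤ c

/-- `c ≤ λ_min(M)`, for a symmetric matrix `M`: every eigenvalue is at least `c`. -/
def LeMinEig {n : Type*} [Fintype n] [DecidableEq n] (c : ℝ) (M : Matrix n n ℝ) : Prop :=
  ∀ μ ∈ spectrum ℝ M, c ≤ μ

/-- The least squares loss `Q(b) = (2p)⁻¹ ‖y yᵀ - Σ(b)‖_F²`. -/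
def loss {p K : ℕ} (W : Fin (K + 1) → Matrix (Fin p) (Fin p) ℝ) (y : Fin p → ℝ)
    (b : Fin (K + 1) → ℝ) : ℝ :=
  (2 * (p : ℝ))⁻¹ * frobNorm (Matrix.vecMulVec y y - cov W b) ^ 2

/-- The coefficient vectors that vanish outside the support of `β`. -/
def supportedOn {K : ℕ} (β : Fin (K + 1) → ℝ) : Set (Fin (K + 1) → ℝ) :=
  {b | ∀ k, β k = 0 → b k = 0}

/-- `b` is the oracle estimate from the observation `y`: a minimizer of the loss among the
coefficient vectors that vanish outside the support of the true coefficient vector `β`. -/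
def IsOracle {p K : ℕ} (W : Fin (K + 1) → Matrix (Fin p) (Fin p) ℝ) (β : Fin (K + 1) → ℝ)
    (y : Fin p → ℝ) (b : Fin (K + 1) → ℝ) : Prop :=
  b ∈ supportedOn β ∧ IsMinOn (loss W y) (supportedOn β) b

/-- `Σ_{W,𝒮} = (tr(Wₖ Wₗ) : k, l ∈ 𝒮)`. -/
def gramS {p K : ℕ} (W : Fin (K + 1) → Matrix (Fin p) (Fin p) ℝ) (β : Fin (K + 1) → ℝ) :
    Matrix (Supp β) (Supp β) ℝ :=
  Matrix.of fun k l => (W k.1 * W l.1).trace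

/-- `G_{d,p} = p⁻¹ (tr(Σ₀ᵈ Wₖ Σ₀ᵈ Wₗ) : k, l ∈ 𝒮)`, with `Σ₀ = Σ(β)`. -/
def Gmat {p K : ℕ} (W : Fin (K + 1) → Matrix (Fin p) (Fin p) ℝ) (β : Fin (K + 1) → ℝ) (d : ℕ) :
    Matrix (Supp β) (Supp β) ℝ :=
  Matrix.of fun k l => (p : ℝ)⁻¹ * (cov W β ^ d * W k.1 * cov W β ^ d * W l.1).trace

/-- `H_p = p⁻¹ (tr[(Σ₀^{1/2} Wₖ Σ₀^{1/2}) ∘ (Σ₀^{1/2} Wₗ Σ₀^{1/2})] : k, l ∈ 𝒮)`, where `∘` is the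
entrywise product and `Σ₀ = Σ(β)`. -/
def Hmat {p K : ℕ} (W : Fin (K + 1) → Matrix (Fin p) (Fin p) ℝ) (β : Fin (K + 1) → ℝ) :
    Matrix (Supp β) (Supp β) ℝ :=
  Matrix.of fun k l => (p : ℝ)⁻¹ *
    (Matrix.hadamard (covSqrt W β * W k.1 * covSqrt W β)
      (covSqrt W β * W l.1 * covSqrt W β)).trace

end

end SCR

/-! The loss is quadratic, so the oracle error solves the normal equations. With `y = Σ₀^{1/2} z`
their right-hand sides are the centred quadratic forms `zᵀ Bₖ z - tr Bₖ` with `Bₖ = Σ₀^{1/2} Wₖ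
Σ₀^{1/2}`, whose column sums are bounded by `σmax * w`. Fix a direction `u` and put `a = Aᵀ u`. The
projected error is then one centred quadratic form `Q = zᵀ M z - tr M`, where `M` is a combination
of the `Bₖ`, plus a remainder caused by `G₀` in place of `G_{0,p}`. By Cauchy-Schwarz `∑ |aₖ| ≤
√(s+1) ‖a‖`, so the normalization `√(p/(s+1))` gives `M` column sums `κ = O(p^{-1/2})`, however fast
`s` grows. The remainder is small in mean square: the error has second moment `O((s+1)/p)` and the
Frobenius distance tends to zero.

What is left is a central limit theorem for `Q` (`norm_charFun_centeredQuad_sub_le`), proved by a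
differential equation for `φ(t) = E exp(itQ)`. Write `Q = ∑ Xⱼ` with `Xⱼ = halfIncr M x j`, and let
`Dⱼ = incr M x j` be the part of `Q` that involves `xⱼ`. Then `Q - Dⱼ` is free of `xⱼ` and `Xⱼ` has
mean zero given the other coordinates, so a Taylor expansion in `Dⱼ` gives `E[Xⱼ exp(itQ)] ≈ it E[Vⱼ
exp(itQ)]`, where `Vⱼ = condCov` is the conditional mean of `Xⱼ Dⱼ`, with an error of order `κ³`
(`norm_integral_halfIncr_sub_le`). The sum of the `Vⱼ` concentrates at `v = quadVar`, with mean
square error `O(p κ⁴)` (`integral_sum_condCov_sub_sq_le`). Hence `φ' ≈ -t v φ`, and integration over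
`[0, 1]` gives `φ(1) ≈ exp(-v/2)` with error `O(p κ³ + √(p κ⁴)) = O(p^{-1/2})`. Since `v` tends to
`uᵀ C u`, Lévy's continuity theorem concludes. -/

namespace SCR

/-! ### Moments of the noise -/

/-- A centred law with unit variance, fourth moment `μ₄` and sixth moment at most `m`. -/
structure IsNoiseLaw (μ₄ m : ℝ) (μ : Measure ℝ) : Prop where
  isProbabilityMeasure : IsProbabilityMeasure μ
  integrable_pow_six : Integrable (fun z => z ^ 6) μ
  mean : ∫ z, z ∂μ = 0
  second : ∫ z, z ^ 2 ∂μ = 1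
  fourth : ∫ z, z ^ 4 ∂μ = μ₄
  sixth : ∫ z, z ^ 6 ∂μ ≤ m

lemma abs_pow_le_one_add_pow_six {k : ℕ} (hk : k ≤ 6) (z : ℝ) : |z ^ k| ≤ 1 + z ^ 6 := by
  rw [abs_pow]
  have h6 : z ^ 6 = |z| ^ 6 := by rw [← abs_pow, abs_of_nonneg (by positivity)]
  rw [h6]
  rcases le_total |z| 1 with h | h
  · have := pow_le_one₀ (n := k) (abs_nonneg z) h
    have := pow_nonneg (abs_nonneg z) 6
    linarith
  · have := pow_le_pow_right₀ h hk
    linarith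

lemma IsNoiseLaw.integrable_pow {μ₄ m : ℝ} {μ : Measure ℝ} (h : IsNoiseLaw μ₄ m μ) {k : ℕ}
    (hk : k ≤ 6) : Integrable (fun z => z ^ k) μ := by
  have := h.isProbabilityMeasure
  exact ((integrable_const 1).add h.integrable_pow_six).mono' (by fun_prop)
    (ae_of_all _ fun z => abs_pow_le_one_add_pow_six hk z)

lemma IsNoiseLaw.abs_integral_pow_le {μ₄ m : ℝ} {μ : Measure ℝ} (h : IsNoiseLaw μ₄ m μ) {k : ℕ}
    (hk : k ≤ 6) : |∫ z, z ^ k ∂μ| ≤ 1 + m := by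
  have := h.isProbabilityMeasure
  calc |∫ z, z ^ k ∂μ| ≤ ∫ z, |z ^ k| ∂μ := abs_integral_le_integral_abs
    _ ≤ ∫ z, (1 + z ^ 6) ∂μ := integral_mono (h.integrable_pow hk).abs
        ((integrable_const 1).add h.integrable_pow_six) fun z => abs_pow_le_one_add_pow_six hk z
    _ = 1 + ∫ z, z ^ 6 ∂μ := by
        rw [integral_add (integrable_const 1) h.integrable_pow_six]; simp
    _ ≤ 1 + m := by linarith [h.sixth]

lemma IsNoiseLaw.sixth_nonneg {μ₄ m : ℝ} {μ : Measure ℝ} (h : IsNoiseLaw μ₄ m μ) : 0 ≤ m :=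
  (integral_nonneg fun z => by positivity).trans h.sixth

/-! ### A column-wise majorant and its moments -/

section Bound

variable {ι : Type*} [Fintype ι]

/-- `∑ᵢ |Mᵢⱼ| (1 + xᵢ² + xⱼ²)`, which bounds the increments of the quadratic form of `M` in the
coordinate `j`. -/
def colBound (M : Matrix ι ι ℝ) (x : ι → ℝ) (j : ι) : ℝ :=
  ∑ i, |M i j| * (1 + x i ^ 2 + x j ^ 2)

lemma colBound_nonneg (M : Matrix ι ι ℝ) (x : ι → ℝ) (j : ι) : 0 ≤ colBound M x j :=
  Finset.sum_nonneg fun i _ => by positivity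

/-- Jensen's inequality with the weights `|a i| / ∑ |a i|`. The bound costs powers of `κ` only and
no factor of the dimension. -/
lemma sum_abs_mul_pow_le {a f : ι → ℝ} {κ : ℝ} (hf : ∀ i, 0 ≤ f i) (ha : ∑ i, |a i| ≤ κ) (k : ℕ) :
    (∑ i, |a i| * f i) ^ (k + 1) ≤ κ ^ k * ∑ i, |a i| * f i ^ (k + 1) := by
  have h0 : 0 ≤ ∑ i, |a i| := Finset.sum_nonneg fun i _ => abs_nonneg _
  have hr : 0 ≤ ∑ i, |a i| * f i ^ (k + 1) :=
    Finset.sum_nonneg fun i _ => mul_nonneg (abs_nonneg _) (pow_nonneg (hf i) _)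
  refine le_trans ?_ (mul_le_mul_of_nonneg_right (pow_le_pow_left₀ h0 ha k) hr)
  rcases h0.eq_or_lt with h | h
  · have h1 : ∀ i, |a i| = 0 := fun i =>
      (Finset.sum_eq_zero_iff_of_nonneg fun i _ => abs_nonneg (a i)).1 h.symm i (Finset.mem_univ i)
    simp [h1]
  · set w := ∑ i, |a i| with hw
    have key := Real.pow_arith_mean_le_arith_mean_pow Finset.univ (fun i => |a i| / w) f
      (fun i _ => by positivity) (by rw [← Finset.sum_div, ← hw, div_self h.ne'])
      (fun i _ => hf i) (k + 1)
    have e1 : ∑ i, |a i| / w * f i = (∑ i, |a i| * f i) / w := by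
      rw [Finset.sum_div]; exact Finset.sum_congr rfl fun i _ => by ring
    have e2 : ∑ i, |a i| / w * f i ^ (k + 1) = (∑ i, |a i| * f i ^ (k + 1)) / w := by
      rw [Finset.sum_div]; exact Finset.sum_congr rfl fun i _ => by ring
    rw [e1, e2, div_pow, div_le_div_iff₀ (by positivity) h] at key
    have h3 : w * (∑ i, |a i| * f i) ^ (k + 1) ≤
        w * (w ^ k * ∑ i, |a i| * f i ^ (k + 1)) := by
      calc _ = (∑ i, |a i| * f i) ^ (k + 1) * w := by ring
        _ ≤ _ := key
        _ = _ := by ring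
    exact le_of_mul_le_mul_left h3 h

lemma colBound_pow_three_le {M : Matrix ι ι ℝ} {κ : ℝ} (hM : OneNormLE M κ) (x : ι → ℝ) (j : ι) :
    colBound M x j ^ 3 ≤ κ ^ 2 * ∑ i, |M i j| * (9 * (1 + x i ^ 6 + x j ^ 6)) := by
  refine (sum_abs_mul_pow_le (fun i => by positivity) (hM j) 2).trans ?_
  refine mul_le_mul_of_nonneg_left (Finset.sum_le_sum fun i _ => ?_) (by positivity)
  refine mul_le_mul_of_nonneg_left ?_ (abs_nonneg _)
  have h : ∀ a b : ℝ, 0 ≤ a → 0 ≤ b → (1 + a + b) ^ 3 ≤ 9 * (1 + a ^ 3 + b ^ 3) := by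
    intro a b ha hb
    nlinarith [mul_nonneg (add_nonneg ha hb) (sq_nonneg (a - b)),
      mul_nonneg (add_nonneg ha zero_le_one) (sq_nonneg (a - 1)),
      mul_nonneg (add_nonneg hb zero_le_one) (sq_nonneg (b - 1)),
      mul_nonneg ha (sq_nonneg (b - 1)), mul_nonneg hb (sq_nonneg (a - 1)), sq_nonneg (a - b)]
  have := h (x i ^ 2) (x j ^ 2) (by positivity) (by positivity)
  rw [← pow_mul, ← pow_mul] at this
  exact this

/-- The square is given the same degree-six majorant as the cube, so that one integral serves both.
The constant 9 arises from `(1+a+b)² ≤ 3(1+a²+b²)` and `a² ≤ 1+a³`. -/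
lemma colBound_sq_le {M : Matrix ι ι ℝ} {κ : ℝ} (hM : OneNormLE M κ) (x : ι → ℝ) (j : ι) :
    colBound M x j ^ 2 ≤ κ * ∑ i, |M i j| * (9 * (1 + x i ^ 6 + x j ^ 6)) := by
  have hκ : 0 ≤ κ := (Finset.sum_nonneg fun i _ => abs_nonneg _).trans (hM j)
  refine (sum_abs_mul_pow_le (k := 1) (fun i => by positivity) (hM j)).trans ?_
  rw [pow_one]
  refine mul_le_mul_of_nonneg_left (Finset.sum_le_sum fun i _ => ?_) hκ
  refine mul_le_mul_of_nonneg_left ?_ (abs_nonneg _)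
  have h : ∀ a b : ℝ, 0 ≤ a → 0 ≤ b → (1 + a + b) ^ 2 ≤ 9 * (1 + a ^ 3 + b ^ 3) := by
    intro a b ha hb
    have h1 : a ^ 2 ≤ 1 + a ^ 3 := by
      nlinarith [mul_nonneg (add_nonneg ha zero_le_one) (sq_nonneg (a - 1)), sq_nonneg (a - 1)]
    have h2 : b ^ 2 ≤ 1 + b ^ 3 := by
      nlinarith [mul_nonneg (add_nonneg hb zero_le_one) (sq_nonneg (b - 1)), sq_nonneg (b - 1)]
    nlinarith [sq_nonneg (a - b), sq_nonneg (a - 1), sq_nonneg (b - 1)]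
  have := h (x i ^ 2) (x j ^ 2) (by positivity) (by positivity)
  rw [← pow_mul, ← pow_mul] at this
  exact this

variable {μ : ι → Measure ℝ} {μ₄ m : ℝ}

lemma integrable_eval_pow (hμ : ∀ i, IsNoiseLaw μ₄ m (μ i)) {k : ℕ} (hk : k ≤ 6) (i : ι) :
    Integrable (fun x : ι → ℝ => x i ^ k) (Measure.pi μ) := by
  have := fun i => (hμ i).isProbabilityMeasure
  exact integrable_comp_eval (X := fun _ => ℝ) (i := i) (f := fun z : ℝ => z ^ k) ((hμ i).integrable_pow hk)

lemma integrable_sum_abs_mul (hμ : ∀ i, IsNoiseLaw μ₄ m (μ i)) (M : Matrix ι ι ℝ) (j : ι) :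
    Integrable (fun x : ι → ℝ => ∑ i, |M i j| * (9 * (1 + x i ^ 6 + x j ^ 6))) (Measure.pi μ) := by
  have := fun i => (hμ i).isProbabilityMeasure
  refine integrable_finsetSum _ fun i _ => Integrable.const_mul (Integrable.const_mul ?_ _) _
  exact ((integrable_const 1).add (integrable_eval_pow hμ le_rfl i)).add
    (integrable_eval_pow hμ le_rfl j)

lemma integral_sum_abs_mul_le (hμ : ∀ i, IsNoiseLaw μ₄ m (μ i)) {M : Matrix ι ι ℝ} {κ : ℝ}
    (hM : OneNormLE M κ) (j : ι) :
    ∫ x, ∑ i, |M i j| * (9 * (1 + x i ^ 6 + x j ^ 6)) ∂(Measure.pi μ) ≤ 18 * (1 + m) * κ := by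
  have := fun i => (hμ i).isProbabilityMeasure
  have hint : ∀ i, Integrable (fun x : ι → ℝ => 1 + x i ^ 6 + x j ^ 6) (Measure.pi μ) := fun i =>
    ((integrable_const 1).add (integrable_eval_pow hμ le_rfl i)).add
      (integrable_eval_pow hμ le_rfl j)
  have h6 : ∀ i, ∫ x : ι → ℝ, x i ^ 6 ∂(Measure.pi μ) ≤ m := fun i => by
    rw [integral_comp_eval (X := fun _ => ℝ) (f := fun z : ℝ => z ^ 6) (by fun_prop)]
    exact (hμ i).sixth
  have hm := (hμ j).sixth_nonneg
  rw [integral_finsetSum _ fun i _ => ((hint i).const_mul 9).const_mul _]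
  -- Each integral is at most `9 (1 + 2m) ≤ 18 (1 + m)`.
  calc _ ≤ ∑ i, |M i j| * (18 * (1 + m)) := by
        refine Finset.sum_le_sum fun i _ => ?_
        rw [integral_const_mul, integral_const_mul]
        refine mul_le_mul_of_nonneg_left ?_ (abs_nonneg _)
        have e : ∫ x : ι → ℝ, 1 + x i ^ 6 ∂(Measure.pi μ) =
            ∫ _, 1 ∂(Measure.pi μ) + ∫ x : ι → ℝ, x i ^ 6 ∂(Measure.pi μ) :=
          integral_add (integrable_const 1) (integrable_eval_pow hμ le_rfl i)
        have e' : ∫ x : ι → ℝ, 1 + x i ^ 6 + x j ^ 6 ∂(Measure.pi μ) =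
            ∫ x : ι → ℝ, 1 + x i ^ 6 ∂(Measure.pi μ) + ∫ x : ι → ℝ, x j ^ 6 ∂(Measure.pi μ) :=
          integral_add ((integrable_const 1).add (integrable_eval_pow hμ le_rfl i))
            (integrable_eval_pow hμ le_rfl j)
        rw [e', e]
        simp only [integral_const, probReal_univ, smul_eq_mul, mul_one]
        linarith [h6 i, h6 j]
    _ = 18 * (1 + m) * ∑ i, |M i j| := by rw [← Finset.sum_mul]; ring
    _ ≤ _ := mul_le_mul_of_nonneg_left (hM j) (by positivity)

lemma measurable_colBound (M : Matrix ι ι ℝ) (j : ι) : Measurable fun x => colBound M x j := by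
  unfold colBound; fun_prop

/-- A crude bound valid for every matrix; it serves integrability only. -/
lemma oneNormLE_sum (M : Matrix ι ι ℝ) : OneNormLE M (∑ j, ∑ i, |M i j|) := fun j =>
  Finset.single_le_sum (f := fun j => ∑ i, |M i j|)
    (fun _ _ => Finset.sum_nonneg fun _ _ => abs_nonneg _) (Finset.mem_univ j)

lemma integrable_colBound_pow_three (hμ : ∀ i, IsNoiseLaw μ₄ m (μ i)) (M : Matrix ι ι ℝ) (j : ι) :
    Integrable (fun x => colBound M x j ^ 3) (Measure.pi μ) :=
  ((integrable_sum_abs_mul hμ M j).const_mul _).mono'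
    ((measurable_colBound M j).pow_const 3).aestronglyMeasurable
    (ae_of_all _ fun x => by
      rw [Real.norm_of_nonneg (pow_nonneg (colBound_nonneg M x j) 3)]
      exact colBound_pow_three_le (oneNormLE_sum M) x j)

lemma integrable_colBound_sq (hμ : ∀ i, IsNoiseLaw μ₄ m (μ i)) (M : Matrix ι ι ℝ) (j : ι) :
    Integrable (fun x => colBound M x j ^ 2) (Measure.pi μ) :=
  ((integrable_sum_abs_mul hμ M j).const_mul _).mono'
    ((measurable_colBound M j).pow_const 2).aestronglyMeasurable
    (ae_of_all _ fun x => by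
      rw [Real.norm_of_nonneg (pow_nonneg (colBound_nonneg M x j) 2)]
      exact colBound_sq_le (oneNormLE_sum M) x j)

lemma integral_colBound_pow_three_le (hμ : ∀ i, IsNoiseLaw μ₄ m (μ i)) {M : Matrix ι ι ℝ} {κ : ℝ}
    (hM : OneNormLE M κ) (j : ι) :
    ∫ x, colBound M x j ^ 3 ∂(Measure.pi μ) ≤ 18 * (1 + m) * κ ^ 3 := by
  refine (integral_mono (integrable_colBound_pow_three hμ M j)
    ((integrable_sum_abs_mul hμ M j).const_mul _) fun x => colBound_pow_three_le hM x j).trans ?_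
  rw [integral_const_mul]
  refine (mul_le_mul_of_nonneg_left (integral_sum_abs_mul_le hμ hM j) (by positivity)).trans_eq ?_
  ring

lemma integral_colBound_sq_le (hμ : ∀ i, IsNoiseLaw μ₄ m (μ i)) {M : Matrix ι ι ℝ} {κ : ℝ}
    (hM : OneNormLE M κ) (j : ι) :
    ∫ x, colBound M x j ^ 2 ∂(Measure.pi μ) ≤ 18 * (1 + m) * κ ^ 2 := by
  have hκ : 0 ≤ κ := (Finset.sum_nonneg fun i _ => abs_nonneg _).trans (hM j)
  refine (integral_mono (integrable_colBound_sq hμ M j)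
    ((integrable_sum_abs_mul hμ M j).const_mul _) fun x => colBound_sq_le hM x j).trans ?_
  rw [integral_const_mul]
  refine (mul_le_mul_of_nonneg_left (integral_sum_abs_mul_le hμ hM j) hκ).trans_eq ?_
  ring

end Bound

/-! ### Splitting a quadratic form along one coordinate -/

section Decomposition

variable {ι : Type*} [Fintype ι] [DecidableEq ι]

/-- The centred quadratic form `xᵀ M x - tr M`. -/
def centeredQuad (M : Matrix ι ι ℝ) (x : ι → ℝ) : ℝ := x ⬝ᵥ M.mulVec x - M.trace

/-- The coordinate `j` of `M x`, without the contribution of `xⱼ`. -/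
def rest (M : Matrix ι ι ℝ) (x : ι → ℝ) (j : ι) : ℝ := M.mulVec (Function.update x j 0) j

/-- The part of the centred quadratic form that depends on `xⱼ`. -/
def incr (M : Matrix ι ι ℝ) (x : ι → ℝ) (j : ι) : ℝ := M j j * (x j ^ 2 - 1) + 2 * (x j * rest M x j)

/-- The summands of the centred quadratic form: its off-diagonal part is shared out evenly. -/
def halfIncr (M : Matrix ι ι ℝ) (x : ι → ℝ) (j : ι) : ℝ := M j j * (x j ^ 2 - 1) + x j * rest M x j

/-- The mean of `halfIncr * incr` over `xⱼ`, given the other coordinates, when `xⱼ` has third moment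
`μ₃ j` and fourth moment `μ₄`. -/
def condCov (μ₃ : ι → ℝ) (μ₄ : ℝ) (M : Matrix ι ι ℝ) (x : ι → ℝ) (j : ι) : ℝ :=
  M j j ^ 2 * (μ₄ - 1) + 3 * μ₃ j * M j j * rest M x j + 2 * rest M x j ^ 2

lemma rest_eq_sum (M : Matrix ι ι ℝ) (x : ι → ℝ) (j : ι) :
    rest M x j = ∑ i, M j i * (if i = j then 0 else x i) := by
  simp only [rest, Matrix.mulVec, dotProduct, Function.update_apply]

lemma mulVec_eq_rest (M : Matrix ι ι ℝ) (x : ι → ℝ) (j : ι) :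
    M.mulVec x j = rest M x j + M j j * x j := by
  rw [rest_eq_sum, Matrix.mulVec, dotProduct, ← Finset.sum_erase_add _ _ (Finset.mem_univ j),
    ← Finset.sum_erase_add (a := j) Finset.univ _ (Finset.mem_univ j)]
  simp only [if_true, mul_zero, add_zero]
  congr 1
  exact Finset.sum_congr rfl fun i hi => by rw [if_neg (Finset.ne_of_mem_erase hi)]

lemma rest_update (M : Matrix ι ι ℝ) (x : ι → ℝ) (j : ι) :
    rest M (Function.update x j 0) j = rest M x j := by
  simp [rest]

lemma sum_halfIncr (M : Matrix ι ι ℝ) (x : ι → ℝ) :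
    ∑ j, halfIncr M x j = centeredQuad M x := by
  simp only [centeredQuad, dotProduct, Matrix.trace, Matrix.diag, mulVec_eq_rest M x,
    ← Finset.sum_sub_distrib]
  exact Finset.sum_congr rfl fun j _ => by simp only [halfIncr]; ring

/-- Expand at `x = update x j 0 + xⱼ eⱼ`; symmetry merges the two cross terms. The first two
summands do not involve `xⱼ`; the term `M j j` compensates the centring of `xⱼ²` in `incr`. -/
lemma centeredQuad_eq_add_incr {M : Matrix ι ι ℝ} (hM : M.IsSymm) (x : ι → ℝ) (j : ι) :
    centeredQuad M x = centeredQuad M (Function.update x j 0) + M j j + incr M x j := by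
  have hx : x = Function.update x j 0 + Pi.single j (x j) := by
    ext i
    rcases eq_or_ne i j with rfl | h
    · simp
    · simp [h]
  have h1 : centeredQuad M x = centeredQuad M (Function.update x j 0 + Pi.single j (x j)) := by
    rw [← hx]
  have h2 : Function.update x j 0 ⬝ᵥ M.col j = M.mulVec (Function.update x j 0) j := by
    rw [dotProduct_comm]
    simp only [Matrix.mulVec, dotProduct, Matrix.col_apply]
    exact Finset.sum_congr rfl fun i _ => by rw [hM.apply]
  rw [h1, centeredQuad, Matrix.mulVec_add, add_dotProduct, dotProduct_add, dotProduct_add,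
    single_dotProduct, single_dotProduct, Matrix.mulVec_single, centeredQuad, incr, rest]
  simp only [op_smul_eq_smul, dotProduct_smul, h2, Pi.smul_apply, smul_eq_mul,
    Matrix.col_apply]
  ring

lemma abs_sum_mul_le_colBound {M : Matrix ι ι ℝ} (hM : M.IsSymm) (x : ι → ℝ) (j : ι) {f : ι → ℝ}
    (hf : ∀ i, |f i| ≤ 1 + x i ^ 2 + x j ^ 2) : |∑ i, M j i * f i| ≤ colBound M x j := by
  refine (Finset.abs_sum_le_sum_abs _ _).trans (Finset.sum_le_sum fun i _ => ?_)
  rw [abs_mul, hM.apply]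
  exact mul_le_mul_of_nonneg_left (hf i) (abs_nonneg _)

lemma abs_rest_le {M : Matrix ι ι ℝ} (hM : M.IsSymm) (x : ι → ℝ) (j : ι) :
    |rest M x j| ≤ colBound M x j := by
  rw [rest_eq_sum]
  refine abs_sum_mul_le_colBound hM x j fun i => ?_
  split_ifs
  · simp; positivity
  · rw [abs_le]
    constructor <;> nlinarith [sq_nonneg (x i - 1), sq_nonneg (x i + 1), sq_nonneg (x j)]

/-- With the diagonal term absorbed into a single row sum, increments can be compared with
`colBound` entry by entry. -/
lemma diag_add_mul_rest (M : Matrix ι ι ℝ) (x : ι → ℝ) (j : ι) (a b : ℝ) :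
    M j j * a + b * rest M x j = ∑ i, M j i * (if i = j then a else b * x i) := by
  rw [rest_eq_sum, Finset.mul_sum, ← Finset.sum_erase_add _ _ (Finset.mem_univ j),
    ← Finset.sum_erase_add (a := j) Finset.univ _ (Finset.mem_univ j)]
  simp only [if_true, mul_zero, add_zero]
  rw [add_comm]
  congr 1
  refine Finset.sum_congr rfl fun i hi => ?_
  rw [if_neg (Finset.ne_of_mem_erase hi), if_neg (Finset.ne_of_mem_erase hi)]
  ring

lemma abs_incr_le {M : Matrix ι ι ℝ} (hM : M.IsSymm) (x : ι → ℝ) (j : ι) :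
    |incr M x j| ≤ colBound M x j := by
  rw [incr, ← mul_assoc, diag_add_mul_rest]
  refine abs_sum_mul_le_colBound hM x j fun i => ?_
  split_ifs with h
  · subst h; rw [abs_le]; constructor <;> nlinarith [sq_nonneg (x i)]
  · rw [abs_le]
    constructor <;> nlinarith [sq_nonneg (x i - x j), sq_nonneg (x i + x j)]

lemma abs_halfIncr_le {M : Matrix ι ι ℝ} (hM : M.IsSymm) (x : ι → ℝ) (j : ι) :
    |halfIncr M x j| ≤ colBound M x j := by
  rw [halfIncr, diag_add_mul_rest]
  refine abs_sum_mul_le_colBound hM x j fun i => ?_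
  split_ifs with h
  · subst h; rw [abs_le]; constructor <;> nlinarith [sq_nonneg (x i)]
  · rw [abs_le]
    constructor <;> nlinarith [sq_nonneg (x i - x j), sq_nonneg (x i + x j)]

lemma abs_diag_le_colBound (M : Matrix ι ι ℝ) (x : ι → ℝ) (j : ι) :
    |M j j| ≤ colBound M x j := by
  refine le_trans ?_ (Finset.single_le_sum (f := fun i => |M i j| * (1 + x i ^ 2 + x j ^ 2))
    (fun i _ => by positivity) (Finset.mem_univ j))
  nlinarith [mul_nonneg (abs_nonneg (M j j)) (sq_nonneg (x j))]

lemma abs_condCov_le {M : Matrix ι ι ℝ} (hM : M.IsSymm) {μ₃ : ι → ℝ} {μ₄ b : ℝ}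
    (h₃ : ∀ j, |μ₃ j| ≤ b) (h₄ : |μ₄| ≤ b) (x : ι → ℝ) (j : ι) :
    |condCov μ₃ μ₄ M x j| ≤ (4 * b + 3) * colBound M x j ^ 2 := by
  have h1 := abs_diag_le_colBound M x j
  have h2 := abs_rest_le hM x j
  have hc := colBound_nonneg M x j
  have hb : 0 ≤ b := (abs_nonneg _).trans h₄
  have hj := h₃ j
  have e1 : |M j j ^ 2 * (μ₄ - 1)| ≤ colBound M x j ^ 2 * (b + 1) := by
    rw [abs_mul, abs_pow]
    have : |μ₄ - 1| ≤ b + 1 := (abs_sub _ _).trans (by simpa using h₄)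
    gcongr
  have e2 : |3 * μ₃ j * M j j * rest M x j| ≤ 3 * b * colBound M x j * colBound M x j := by
    rw [abs_mul, abs_mul, abs_mul, abs_of_pos (by norm_num : (0 : ℝ) < 3)]
    gcongr
  have e3 : |2 * rest M x j ^ 2| ≤ 2 * colBound M x j ^ 2 := by
    rw [abs_mul, abs_pow, abs_of_pos (by norm_num : (0 : ℝ) < 2)]
    gcongr
  -- The three coefficients add up to `(b + 1) + 3b + 2 = 4b + 3`.
  calc _ ≤ |M j j ^ 2 * (μ₄ - 1)| + |3 * μ₃ j * M j j * rest M x j| + |2 * rest M x j ^ 2| :=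
        abs_add_three _ _ _
    _ ≤ _ := by nlinarith

lemma abs_centeredQuad_le {M : Matrix ι ι ℝ} (hM : M.IsSymm) (x : ι → ℝ) :
    |centeredQuad M x| ≤ ∑ j, colBound M x j := by
  rw [← sum_halfIncr]
  exact (Finset.abs_sum_le_sum_abs _ _).trans (Finset.sum_le_sum fun j _ => abs_halfIncr_le hM x j)

@[fun_prop]
lemma continuous_centeredQuad (M : Matrix ι ι ℝ) : Continuous (centeredQuad M) := by
  unfold centeredQuad Matrix.mulVec dotProduct; fun_prop

@[fun_prop]
lemma continuous_rest (M : Matrix ι ι ℝ) (j : ι) : Continuous fun x => rest M x j := by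
  simp only [rest_eq_sum]
  refine continuous_finsetSum _ fun i _ => continuous_const.mul ?_
  split_ifs <;> fun_prop

@[fun_prop]
lemma continuous_incr (M : Matrix ι ι ℝ) (j : ι) : Continuous fun x => incr M x j := by
  unfold incr; fun_prop

@[fun_prop]
lemma continuous_halfIncr (M : Matrix ι ι ℝ) (j : ι) : Continuous fun x => halfIncr M x j := by
  unfold halfIncr; fun_prop

@[fun_prop]
lemma continuous_condCov (μ₃ : ι → ℝ) (μ₄ : ℝ) (M : Matrix ι ι ℝ) (j : ι) :
    Continuous fun x => condCov μ₃ μ₄ M x j := by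
  unfold condCov; fun_prop

end Decomposition

/-! ### Integrating out one coordinate -/

section Independence

variable {ι : Type*} [Fintype ι] [DecidableEq ι] {μ : ι → Measure ℝ} {μ₄ m : ℝ}
  {E : Type*} [NormedAddCommGroup E] [NormedSpace ℝ E]

lemma measurable_update_zero (j : ι) : Measurable fun x : ι → ℝ => Function.update x j 0 := by
  fun_prop

/-- `update x j 0` is a measurable function of the coordinates other than `j`, and disjoint blocks
of independent coordinates are independent. -/
lemma indepFun_eval_update [∀ i, IsProbabilityMeasure (μ i)] (j : ι) :
    IndepFun (fun x : ι → ℝ => x j) (fun x => Function.update x j 0) (Measure.pi μ) := by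
  have h := iIndepFun_pi (μ := μ) (X := fun _ z => z) (fun i => aemeasurable_id)
  have h2 := h.indepFun_finset {j} (Finset.univ.erase j) (by simp) (fun i => measurable_pi_apply i)
  let φ : (({j} : Finset ι) → ℝ) → ℝ := fun y => y ⟨j, by simp⟩
  let ψ : ({i // i ∈ Finset.univ.erase j} → ℝ) → ι → ℝ := fun y i =>
    if hi : i ∈ Finset.univ.erase j then y ⟨i, hi⟩ else 0
  have hφ : Measurable φ := by fun_prop
  have hψ : Measurable ψ := by
    refine measurable_pi_iff.2 fun i => ?_
    by_cases hi : i ∈ Finset.univ.erase j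
    · simp only [ψ, dif_pos hi]; fun_prop
    · simp only [ψ, dif_neg hi]; fun_prop
  have h3 := h2.comp hφ hψ
  have e : (ψ ∘ fun (x : ι → ℝ) (i : {i // i ∈ Finset.univ.erase j}) => x i) =
      fun x => Function.update x j 0 := by
    ext x i
    rcases eq_or_ne i j with rfl | hi
    · simp [ψ]
    · simp [ψ, hi]
  rw [e] at h3
  exact h3

lemma integral_eval_smul_update [∀ i, IsProbabilityMeasure (μ i)] (j : ι) {g : ℝ → ℝ}
    (hg : Measurable g) {h : (ι → ℝ) → E} (hh : StronglyMeasurable h) :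
    ∫ x, g (x j) • h (Function.update x j 0) ∂(Measure.pi μ) =
      (∫ z, g z ∂(μ j)) • ∫ x, h (Function.update x j 0) ∂(Measure.pi μ) := by
  rw [(indepFun_eval_update j).integral_fun_comp_smul_comp (measurable_pi_apply j).aemeasurable
    (measurable_update_zero j).aemeasurable
    hg.aestronglyMeasurable hh.aestronglyMeasurable,
    integral_comp_eval (X := fun _ => ℝ) hg.aestronglyMeasurable]

lemma integrable_eval_smul_update [∀ i, IsProbabilityMeasure (μ i)] (j : ι) {g : ℝ → ℝ}
    (hg : Measurable g) (hgi : Integrable g (μ j)) {h : (ι → ℝ) → E} (hh : StronglyMeasurable h)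
    (hhi : Integrable (fun x => h (Function.update x j 0)) (Measure.pi μ)) :
    Integrable (fun x => g (x j) • h (Function.update x j 0)) (Measure.pi μ) := by
  borelize E
  exact ((indepFun_eval_update j).comp hg hh.measurable).integrable_smul
    (integrable_comp_eval (X := fun _ => ℝ) hgi) hhi

/-- Given the other coordinates, `xⱼ² - 1` and `xⱼ` both have mean zero. Vector values of `h` cover
real functions and complex characters alike. -/
lemma integral_halfIncr_smul (hμ : ∀ i, IsNoiseLaw μ₄ m (μ i)) (M : Matrix ι ι ℝ) (j : ι)
    {h : (ι → ℝ) → E} (hh : StronglyMeasurable h)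
    (h0 : Integrable (fun x => h (Function.update x j 0)) (Measure.pi μ))
    (h1 : Integrable (fun x => rest M x j • h (Function.update x j 0)) (Measure.pi μ)) :
    ∫ x, halfIncr M x j • h (Function.update x j 0) ∂(Measure.pi μ) = 0 := by
  have := fun i => (hμ i).isProbabilityMeasure
  have hr : StronglyMeasurable fun x => rest M x j • h x :=
    (continuous_rest M j).stronglyMeasurable.smul hh
  have hr1 : Integrable (fun x => rest M (Function.update x j 0) j • h (Function.update x j 0))
      (Measure.pi μ) := by simpa only [rest_update] using h1
  have hg : Integrable (fun z => M j j * (z ^ 2 - 1)) (μ j) :=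
    (((hμ j).integrable_pow (by norm_num)).sub (integrable_const 1)).const_mul _
  have hz : Integrable (fun z : ℝ => z) (μ j) := by
    simpa using (hμ j).integrable_pow (k := 1) (by norm_num)
  have e : ∀ x, halfIncr M x j • h (Function.update x j 0) =
      (M j j * (x j ^ 2 - 1)) • h (Function.update x j 0) +
      x j • rest M (Function.update x j 0) j • h (Function.update x j 0) := fun x => by
    rw [halfIncr, rest_update, add_smul, mul_smul (x j)]
  simp only [e]
  rw [integral_add
    (integrable_eval_smul_update j (g := fun z => M j j * (z ^ 2 - 1)) (by fun_prop) hg hh h0)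
    (integrable_eval_smul_update j (g := fun z => z) measurable_id hz hr hr1),
    integral_eval_smul_update j (g := fun z => M j j * (z ^ 2 - 1)) (by fun_prop) hh,
    integral_eval_smul_update j (g := fun z => z) measurable_id hr, (hμ j).mean,
    integral_const_mul, integral_sub ((hμ j).integrable_pow (by norm_num)) (integrable_const 1),
    (hμ j).second]
  simp

/-- This is the sense in which `condCov` is a conditional expectation. The difference is a
polynomial of degree two in `rest M x j`, and its coefficients `g₀`, `g₁`, `g₂` depend on `xⱼ` alone
and have mean zero. -/
lemma integral_halfIncr_mul_incr_smul (hμ : ∀ i, IsNoiseLaw μ₄ m (μ i)) (M : Matrix ι ι ℝ) (j : ι)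
    {h : (ι → ℝ) → E} (hh : StronglyMeasurable h)
    (h0 : Integrable (fun x => h (Function.update x j 0)) (Measure.pi μ))
    (h1 : Integrable (fun x => rest M x j • h (Function.update x j 0)) (Measure.pi μ))
    (h2 : Integrable (fun x => rest M x j ^ 2 • h (Function.update x j 0)) (Measure.pi μ)) :
    ∫ x, (halfIncr M x j * incr M x j - condCov (fun i => ∫ z, z ^ 3 ∂(μ i)) μ₄ M x j) •
      h (Function.update x j 0) ∂(Measure.pi μ) = 0 := by
  have := fun i => (hμ i).isProbabilityMeasure
  have hi : ∀ k ≤ 6, Integrable (fun z => z ^ k) (μ j) := fun k hk => (hμ j).integrable_pow hk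
  have i1 : Integrable (fun z : ℝ => z) (μ j) := by simpa using hi 1 (by norm_num)
  have hr : StronglyMeasurable fun x => rest M x j • h x :=
    (continuous_rest M j).stronglyMeasurable.smul hh
  have hr2 : StronglyMeasurable fun x => rest M x j ^ 2 • h x :=
    ((continuous_rest M j).pow 2).stronglyMeasurable.smul hh
  have h1' : Integrable (fun x => rest M (Function.update x j 0) j • h (Function.update x j 0))
      (Measure.pi μ) := by simpa only [rest_update] using h1
  have h2' : Integrable (fun x => rest M (Function.update x j 0) j ^ 2 •
      h (Function.update x j 0)) (Measure.pi μ) := by simpa only [rest_update] using h2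
  set μ₃ := fun i => ∫ z, z ^ 3 ∂(μ i) with hμ₃
  let g₀ : ℝ → ℝ := fun z => M j j ^ 2 * (z ^ 4 - 2 * z ^ 2 + 1 - (μ₄ - 1))
  let g₁ : ℝ → ℝ := fun z => 3 * M j j * (z ^ 3 - z - μ₃ j)
  let g₂ : ℝ → ℝ := fun z => 2 * (z ^ 2 - 1)
  have m0 : Measurable g₀ := by fun_prop
  have m1 : Measurable g₁ := by fun_prop
  have m2 : Measurable g₂ := by fun_prop
  have i42 : Integrable (fun z : ℝ => z ^ 4 - 2 * z ^ 2) (μ j) :=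
    (hi 4 (by norm_num)).sub ((hi 2 (by norm_num)).const_mul 2)
  have i421 : Integrable (fun z : ℝ => z ^ 4 - 2 * z ^ 2 + 1) (μ j) := i42.add (integrable_const 1)
  have i31 : Integrable (fun z : ℝ => z ^ 3 - z) (μ j) := (hi 3 (by norm_num)).sub i1
  have ig0 : Integrable g₀ (μ j) := (i421.sub (integrable_const _)).const_mul _
  have ig1 : Integrable g₁ (μ j) := (i31.sub (integrable_const _)).const_mul _
  have ig2 : Integrable g₂ (μ j) := ((hi 2 (by norm_num)).sub (integrable_const _)).const_mul _
  have z0 : ∫ z, g₀ z ∂(μ j) = 0 := by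
    simp only [g₀]
    rw [integral_const_mul, integral_sub i421 (integrable_const _),
      integral_add i42 (integrable_const _),
      integral_sub (hi 4 (by norm_num)) ((hi 2 (by norm_num)).const_mul 2), integral_const_mul,
      (hμ j).second, (hμ j).fourth]
    simp only [integral_const, probReal_univ, one_smul]
    ring
  have z1 : ∫ z, g₁ z ∂(μ j) = 0 := by
    simp only [g₁]
    rw [integral_const_mul, integral_sub i31 (integrable_const _),
      integral_sub (hi 3 (by norm_num)) i1, (hμ j).mean]
    simp [hμ₃]
  have z2 : ∫ z, g₂ z ∂(μ j) = 0 := by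
    simp only [g₂]
    rw [integral_const_mul, integral_sub (hi 2 (by norm_num)) (integrable_const _),
      (hμ j).second]
    simp
  have e : ∀ x, (halfIncr M x j * incr M x j - condCov μ₃ μ₄ M x j) • h (Function.update x j 0) =
      (g₀ (x j) • h (Function.update x j 0) +
      g₁ (x j) • rest M (Function.update x j 0) j • h (Function.update x j 0)) +
      g₂ (x j) • rest M (Function.update x j 0) j ^ 2 • h (Function.update x j 0) := fun x => by
    rw [rest_update, ← mul_smul, ← mul_smul, ← add_smul, ← add_smul]
    congr 1
    simp only [halfIncr, incr, condCov, g₀, g₁, g₂]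
    ring
  have a0 := integrable_eval_smul_update j m0 ig0 hh h0
  have a1 := integrable_eval_smul_update j m1 ig1 hr h1'
  have a2 := integrable_eval_smul_update j m2 ig2 hr2 h2'
  simp only [e]
  refine (integral_add (a0.add a1) a2).trans ?_
  refine (congrArg₂ (· + ·) (integral_add a0 a1) rfl).trans ?_
  rw [integral_eval_smul_update j m0 hh, integral_eval_smul_update j m1 hr,
    integral_eval_smul_update j m2 hr2, z0, z1, z2]
  simp

end Independence

/-! ### Maximal column sums -/

section OneNorm

variable {m n l : Type*} [Fintype m] [Fintype n]

lemma OneNormLE.mul {M : Matrix m n ℝ} {N : Matrix n l ℝ} {a b : ℝ} (hM : OneNormLE M a)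
    (hN : OneNormLE N b) (ha : 0 ≤ a) : OneNormLE (M * N) (a * b) := fun j => by
  calc ∑ i, |(M * N) i j| ≤ ∑ i, ∑ k, |M i k| * |N k j| := by
        refine Finset.sum_le_sum fun i _ => ?_
        rw [Matrix.mul_apply]
        exact (Finset.abs_sum_le_sum_abs _ _).trans_eq (Finset.sum_congr rfl fun k _ => abs_mul _ _)
    _ = ∑ k, (∑ i, |M i k|) * |N k j| := by
        rw [Finset.sum_comm]; simp_rw [Finset.sum_mul]
    _ ≤ ∑ k, a * |N k j| :=
        Finset.sum_le_sum fun k _ => mul_le_mul_of_nonneg_right (hM k) (abs_nonneg _)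
    _ ≤ a * b := by rw [← Finset.mul_sum]; exact mul_le_mul_of_nonneg_left (hN j) ha

lemma OneNormLE.abs_apply_le {M : Matrix m n ℝ} {a : ℝ} (hM : OneNormLE M a) (i : m) (j : n) :
    |M i j| ≤ a :=
  (Finset.single_le_sum (f := fun i => |M i j|) (fun _ _ => abs_nonneg _)
    (Finset.mem_univ i)).trans (hM j)

end OneNorm

/-! ### Second moments and concentration of the conditional covariances -/

section Moments

variable {ι : Type*} [Fintype ι] [DecidableEq ι] {μ : ι → Measure ℝ} {μ₄ m : ℝ}

lemma memLp_colBound (hμ : ∀ i, IsNoiseLaw μ₄ m (μ i)) (M : Matrix ι ι ℝ) (j : ι) :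
    MemLp (fun x => colBound M x j) 2 (Measure.pi μ) :=
  (memLp_two_iff_integrable_sq (measurable_colBound M j).aestronglyMeasurable).2
    (integrable_colBound_sq hμ M j)

lemma memLp_of_abs_le_colBound (hμ : ∀ i, IsNoiseLaw μ₄ m (μ i)) {M : Matrix ι ι ℝ} {j : ι}
    {f : (ι → ℝ) → ℝ} (hf : Continuous f) (h : ∀ x, |f x| ≤ colBound M x j) :
    MemLp f 2 (Measure.pi μ) :=
  (memLp_colBound hμ M j).mono' hf.aestronglyMeasurable (ae_of_all _ h)

lemma memLp_centeredQuad (hμ : ∀ i, IsNoiseLaw μ₄ m (μ i)) {M : Matrix ι ι ℝ} (hM : M.IsSymm) :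
    MemLp (centeredQuad M) 2 (Measure.pi μ) := by
  have h := memLp_finsetSum Finset.univ (fun j _ => memLp_colBound hμ M j)
  refine h.mono' (continuous_centeredQuad M).aestronglyMeasurable (ae_of_all _ fun x => ?_)
  exact abs_centeredQuad_le hM x

/-- The second moment of a centred quadratic form. -/
lemma integral_centeredQuad_sq_le (hμ : ∀ i, IsNoiseLaw μ₄ m (μ i)) {M : Matrix ι ι ℝ}
    (hM : M.IsSymm) {κ : ℝ} (hκ : OneNormLE M κ) :
    ∫ x, centeredQuad M x ^ 2 ∂(Measure.pi μ) ≤ Fintype.card ι * (18 * (1 + m) * κ ^ 2) := by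
  have := fun i => (hμ i).isProbabilityMeasure
  have hS := memLp_centeredQuad hμ hM
  have hX : ∀ j, MemLp (fun x => halfIncr M x j) 2 (Measure.pi μ) := fun j =>
    memLp_of_abs_le_colBound hμ (continuous_halfIncr M j) fun x => abs_halfIncr_le hM x j
  have hD : ∀ j, MemLp (fun x => incr M x j) 2 (Measure.pi μ) := fun j =>
    memLp_of_abs_le_colBound hμ (continuous_incr M j) fun x => abs_incr_le hM x j
  have hR : ∀ j, MemLp (fun x => rest M x j) 2 (Measure.pi μ) := fun j =>
    memLp_of_abs_le_colBound hμ (continuous_rest M j) fun x => abs_rest_le hM x j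
  -- `halfIncr` is orthogonal to `centeredQuad M x - incr M x j`, which is free of `xⱼ`. Only
  -- `halfIncr * incr` survives, so each `j` contributes a bounded amount and the total is linear in
  -- the dimension.
  have key : ∀ j, ∫ x, halfIncr M x j * centeredQuad M x ∂(Measure.pi μ) ≤
      18 * (1 + m) * κ ^ 2 := by
    intro j
    let h : (ι → ℝ) → ℝ := fun y => centeredQuad M y + M j j
    have hh : StronglyMeasurable h :=
      ((continuous_centeredQuad M).add continuous_const).stronglyMeasurable
    have e : ∀ x, h (Function.update x j 0) = centeredQuad M x - incr M x j := fun x => by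
      simp only [h, centeredQuad_eq_add_incr hM x j]; ring
    have hL : MemLp (fun x => h (Function.update x j 0)) 2 (Measure.pi μ) := by
      simp only [e]; exact hS.sub (hD j)
    have z := integral_halfIncr_smul hμ M j hh (hL.integrable (by norm_num))
      ((hR j).integrable_mul hL)
    have e2 : ∀ x, halfIncr M x j * centeredQuad M x =
        halfIncr M x j • h (Function.update x j 0) + halfIncr M x j * incr M x j := fun x => by
      rw [e, smul_eq_mul]; ring
    have i1 : Integrable (fun x => halfIncr M x j • h (Function.update x j 0)) (Measure.pi μ) :=
      (hX j).integrable_mul hL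
    have i2 : Integrable (fun x => halfIncr M x j * incr M x j) (Measure.pi μ) :=
      (hX j).integrable_mul (hD j)
    simp only [e2]
    rw [integral_add i1 i2, z, zero_add]
    refine (integral_mono i2 (integrable_colBound_sq hμ M j) fun x => ?_).trans
      (integral_colBound_sq_le hμ hκ j)
    calc halfIncr M x j * incr M x j ≤ |halfIncr M x j| * |incr M x j| := by
          rw [← abs_mul]; exact le_abs_self _
      _ ≤ colBound M x j * colBound M x j := by
          have := colBound_nonneg M x j
          have := abs_halfIncr_le hM x j
          have := abs_incr_le hM x j
          gcongr
      _ = _ := (sq _).symm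
  have e : ∀ x, centeredQuad M x ^ 2 = ∑ j, halfIncr M x j * centeredQuad M x := fun x => by
    rw [← Finset.sum_mul, sum_halfIncr, sq]
  simp only [e]
  have hint : ∀ j, Integrable (fun x => halfIncr M x j * centeredQuad M x) (Measure.pi μ) :=
    fun j => (hX j).integrable_mul hS
  rw [integral_finsetSum _ fun j _ => hint j]
  refine (Finset.sum_le_sum fun j _ => key j).trans_eq ?_
  simp

/-- The second moment of a linear form. -/
lemma integral_linear_sq (hμ : ∀ i, IsNoiseLaw μ₄ m (μ i)) (b : ι → ℝ) :
    ∫ x, (∑ i, b i * x i) ^ 2 ∂(Measure.pi μ) = ∑ i, b i ^ 2 := by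
  have := fun i => (hμ i).isProbabilityMeasure
  have hi : ∀ i, MemLp (fun x : ι → ℝ => x i) 2 (Measure.pi μ) := fun i =>
    (memLp_two_iff_integrable_sq (measurable_pi_apply i).aestronglyMeasurable).2
      (integrable_eval_pow hμ (by norm_num) i)
  have cross : ∀ i j, ∫ x : ι → ℝ, x i * x j ∂(Measure.pi μ) = if i = j then 1 else 0 := by
    intro i j
    split_ifs with h
    · subst h
      simp only [← sq]
      rw [integral_comp_eval (X := fun _ => ℝ) (f := fun z : ℝ => z ^ 2) (by fun_prop)]
      exact (hμ i).second
    · have hind := (iIndepFun_pi (μ := μ) (X := fun _ z => z) fun i => aemeasurable_id).indepFun h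
      rw [hind.integral_fun_mul_eq_mul_integral (measurable_pi_apply i).aestronglyMeasurable
        (measurable_pi_apply j).aestronglyMeasurable,
        integral_comp_eval (X := fun _ => ℝ) (f := fun z : ℝ => z) (by fun_prop), (hμ i).mean,
        zero_mul]
  have e : ∀ x : ι → ℝ, (∑ i, b i * x i) ^ 2 = ∑ i, ∑ j, (b i * b j) * (x i * x j) := fun x => by
    rw [sq, Finset.sum_mul_sum]
    exact Finset.sum_congr rfl fun i _ => Finset.sum_congr rfl fun j _ => by ring
  have hint : ∀ i j, Integrable (fun x : ι → ℝ => (b i * b j) * (x i * x j)) (Measure.pi μ) :=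
    fun i j => ((hi i).integrable_mul (hi j)).const_mul _
  simp only [e]
  rw [integral_finsetSum _ fun i _ => integrable_finsetSum _ fun j _ => hint i j]
  refine Finset.sum_congr rfl fun i _ => ?_
  rw [integral_finsetSum _ fun j _ => hint i j]
  simp only [integral_const_mul, cross, mul_ite, mul_one, mul_zero, Finset.sum_ite_eq,
    Finset.mem_univ, if_true]
  ring

/-- The variance of the quadratic form of `M` at a noise vector. -/
def quadVar (μ₄ : ℝ) (M : Matrix ι ι ℝ) : ℝ := 2 * (M * M).trace + (μ₄ - 3) * ∑ j, M j j ^ 2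

/-- The off-diagonal part of a matrix. -/
def offDiag (M : Matrix ι ι ℝ) : Matrix ι ι ℝ := Matrix.of fun j i => if i = j then 0 else M j i

lemma offDiag_isSymm {M : Matrix ι ι ℝ} (hM : M.IsSymm) : (offDiag M).IsSymm := by
  ext i j
  simp only [offDiag, Matrix.transpose_apply, Matrix.of_apply, eq_comm (a := i), hM.apply]

lemma rest_eq_offDiag_mulVec (M : Matrix ι ι ℝ) (x : ι → ℝ) (j : ι) :
    rest M x j = (offDiag M).mulVec x j := by
  rw [rest_eq_sum, Matrix.mulVec, dotProduct]
  exact Finset.sum_congr rfl fun i _ => by simp only [offDiag, Matrix.of_apply]; split_ifs <;> simp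

lemma oneNormLE_offDiag {M : Matrix ι ι ℝ} {κ : ℝ} (h : OneNormLE M κ) :
    OneNormLE (offDiag M) κ := fun j =>
  (Finset.sum_le_sum fun i _ => by
    simp only [offDiag, Matrix.of_apply]; split_ifs <;> simp).trans (h j)

/-- Separating the diagonal from `tr M²` turns `μ₄ - 3` into `μ₄ - 1` and brings the variance to the
shape of the mean of `∑ condCov`. -/
lemma quadVar_eq (M : Matrix ι ι ℝ) (μ₄ : ℝ) :
    quadVar μ₄ M = ∑ j, M j j ^ 2 * (μ₄ - 1) + 2 * (offDiag M * offDiag M).trace := by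
  have h : (M * M).trace = (offDiag M * offDiag M).trace + ∑ j, M j j ^ 2 := by
    simp only [Matrix.trace, Matrix.diag, Matrix.mul_apply, ← Finset.sum_add_distrib]
    refine Finset.sum_congr rfl fun j _ => ?_
    rw [← Finset.sum_erase_add _ _ (Finset.mem_univ j),
      ← Finset.sum_erase_add (a := j) Finset.univ _ (Finset.mem_univ j)]
    have : ∑ i ∈ Finset.univ.erase j, offDiag M j i * offDiag M i j =
        ∑ i ∈ Finset.univ.erase j, M j i * M i j := Finset.sum_congr rfl fun i hi => by
      simp [offDiag, Finset.ne_of_mem_erase hi, (Finset.ne_of_mem_erase hi).symm]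
    rw [this]
    simp [offDiag]
    ring
  rw [quadVar, h, ← Finset.sum_mul]
  ring

/-- The fluctuation of the conditional covariances is a linear form, due to the third moments, plus
a centred quadratic form. The second moments of both are already under control. -/
lemma sum_condCov {M : Matrix ι ι ℝ} (hM : M.IsSymm) (μ₃ : ι → ℝ) (μ₄ : ℝ) (x : ι → ℝ) :
    ∑ j, condCov μ₃ μ₄ M x j - quadVar μ₄ M =
      ∑ i, (∑ j, 3 * μ₃ j * M j j * offDiag M j i) * x i +
        2 * centeredQuad (offDiag M * offDiag M) x := by
  have h1 : ∑ j, rest M x j ^ 2 = x ⬝ᵥ (offDiag M * offDiag M).mulVec x := by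
    rw [← Matrix.mulVec_mulVec, Matrix.dotProduct_mulVec, ← Matrix.mulVec_transpose,
      offDiag_isSymm hM]
    simp only [dotProduct, ← rest_eq_offDiag_mulVec, sq]
  have h2 : ∑ j, 3 * μ₃ j * M j j * rest M x j =
      ∑ i, (∑ j, 3 * μ₃ j * M j j * offDiag M j i) * x i := by
    simp only [rest_eq_offDiag_mulVec, Matrix.mulVec, dotProduct, Finset.mul_sum, Finset.sum_mul]
    rw [Finset.sum_comm]
    exact Finset.sum_congr rfl fun i _ => Finset.sum_congr rfl fun j _ => by ring
  rw [quadVar_eq M, centeredQuad, ← h1, ← h2]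
  simp only [condCov, Finset.sum_add_distrib, ← Finset.mul_sum]
  ring

lemma offDiag_sq_isSymm {M : Matrix ι ι ℝ} (hM : M.IsSymm) :
    (offDiag M * offDiag M).IsSymm := by
  rw [Matrix.IsSymm, Matrix.transpose_mul, offDiag_isSymm hM]

/-- The conditional covariances concentrate: their sum is close to the variance of the quadratic
form. -/
lemma integral_sum_condCov_sub_sq_le (hμ : ∀ i, IsNoiseLaw μ₄ m (μ i)) {M : Matrix ι ι ℝ}
    (hM : M.IsSymm) {κ : ℝ} (hκ : OneNormLE M κ) (hm : 0 ≤ m) :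
    MemLp (fun x => ∑ j, condCov (fun i => ∫ z, z ^ 3 ∂(μ i)) μ₄ M x j - quadVar μ₄ M) 2
      (Measure.pi μ) ∧
    ∫ x, (∑ j, condCov (fun i => ∫ z, z ^ 3 ∂(μ i)) μ₄ M x j - quadVar μ₄ M) ^ 2
      ∂(Measure.pi μ) ≤ Fintype.card ι * (162 * (1 + m) ^ 2 * κ ^ 4) := by
  have := fun i => (hμ i).isProbabilityMeasure
  simp only [sum_condCov hM]
  set μ₃ := fun i => ∫ z, z ^ 3 ∂(μ i) with hμ₃
  set b : ι → ℝ := fun i => ∑ j, 3 * μ₃ j * M j j * offDiag M j i with hb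
  set N := offDiag M * offDiag M with hN
  have hNs : N.IsSymm := offDiag_sq_isSymm hM
  have hi : ∀ i, MemLp (fun x : ι → ℝ => x i) 2 (Measure.pi μ) := fun i =>
    (memLp_two_iff_integrable_sq (measurable_pi_apply i).aestronglyMeasurable).2
      (integrable_eval_pow hμ (by norm_num) i)
  have hl : MemLp (fun x : ι → ℝ => ∑ i, b i * x i) 2 (Measure.pi μ) :=
    memLp_finsetSum _ fun i _ => (hi i).const_mul _
  have hq : MemLp (fun x => 2 * centeredQuad N x) 2 (Measure.pi μ) :=
    (memLp_centeredQuad hμ hNs).const_mul 2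
  refine ⟨hl.add hq, ?_⟩
  rcases isEmpty_or_nonempty ι with hι | hι
  · simp [centeredQuad, Matrix.trace]
  have hκ0 : 0 ≤ κ := (abs_nonneg _).trans (hκ.abs_apply_le (Classical.arbitrary ι)
    (Classical.arbitrary ι))
  have hbi : ∀ i, |b i| ≤ 3 * (1 + m) * κ * κ := fun i => by
    calc |b i| ≤ ∑ j, 3 * (1 + m) * κ * |offDiag M j i| := by
          refine (Finset.abs_sum_le_sum_abs _ _).trans (Finset.sum_le_sum fun j _ => ?_)
          rw [abs_mul, abs_mul, abs_mul, abs_of_pos (by norm_num : (0 : ℝ) < 3)]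
          have h1 := (hμ j).abs_integral_pow_le (k := 3) (by norm_num)
          have h2 := hκ.abs_apply_le j j
          gcongr
      _ ≤ _ := by
          rw [← Finset.mul_sum]
          exact mul_le_mul_of_nonneg_left (oneNormLE_offDiag hκ i) (by positivity)
  have hN1 : OneNormLE N (κ * κ) := (oneNormLE_offDiag hκ).mul (oneNormLE_offDiag hκ) hκ0
  calc _ ≤ ∫ x, (2 * (∑ i, b i * x i) ^ 2 + 8 * centeredQuad N x ^ 2) ∂(Measure.pi μ) := by
        refine integral_mono (hl.add hq).integrable_sq
          ((hl.integrable_sq.const_mul 2).add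
            ((memLp_centeredQuad hμ hNs).integrable_sq.const_mul 8)) fun x => ?_
        nlinarith [sq_nonneg (∑ i, b i * x i - 2 * centeredQuad N x)]
    _ = 2 * ∑ i, b i ^ 2 + 8 * ∫ x, centeredQuad N x ^ 2 ∂(Measure.pi μ) := by
        rw [integral_add (hl.integrable_sq.const_mul 2)
          ((memLp_centeredQuad hμ hNs).integrable_sq.const_mul 8), integral_const_mul,
          integral_const_mul, integral_linear_sq hμ]
    _ ≤ 2 * ∑ _ : ι, (3 * (1 + m) * κ * κ) ^ 2 +
          8 * (Fintype.card ι * (18 * (1 + m) * (κ * κ) ^ 2)) := by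
        refine add_le_add (mul_le_mul_of_nonneg_left (Finset.sum_le_sum fun i _ => ?_) zero_le_two)
          (mul_le_mul_of_nonneg_left (integral_centeredQuad_sq_le hμ hNs hN1) (by norm_num))
        exact sq_le_sq' (abs_le.1 (hbi i)).1 (abs_le.1 (hbi i)).2
    _ ≤ _ := by
        simp only [Finset.sum_const, Finset.card_univ, nsmul_eq_mul]
        -- The linear part gives `2 * 9 = 18` and the quadratic part `8 * 18 = 144`, together 162.
        have h1 : (1 + m) ≤ (1 + m) ^ 2 := by nlinarith
        have h2 : (0 : ℝ) ≤ Fintype.card ι * κ ^ 4 := by positivity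
        nlinarith [mul_le_mul_of_nonneg_left h1 h2]

end Moments

/-! ### The central limit theorem for quadratic forms -/

section CharFun

lemma norm_exp_mul_I_sub_one_le (x : ℝ) : ‖Complex.exp (x * Complex.I) - 1‖ ≤ |x| := by
  rw [mul_comm]
  exact Real.norm_exp_I_mul_ofReal_sub_one_le

/-- For `|x| ≥ 1` the triangle inequality gives `2|x| ≤ 2x²`, for `|x| ≤ 1` the power series does;
no sharp constant is needed. -/
lemma norm_exp_mul_I_sub_one_sub_le (x : ℝ) :
    ‖Complex.exp (x * Complex.I) - 1 - x * Complex.I‖ ≤ 2 * x ^ 2 := by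
  have hx : ‖(x : ℂ) * Complex.I‖ = |x| := by simp
  rcases le_total |x| 1 with h | h
  · refine (Complex.norm_exp_sub_one_sub_id_le (hx.trans_le h)).trans ?_
    rw [hx, sq_abs]
    nlinarith [sq_nonneg x]
  · refine (norm_sub_le _ _).trans ?_
    rw [hx, ← sq_abs]
    nlinarith [norm_exp_mul_I_sub_one_le x]

variable {ι : Type*} [Fintype ι] [DecidableEq ι] {μ : ι → Measure ℝ} {μ₄ m : ℝ}

lemma norm_exp_ofReal_mul_ofReal_mul_I (a b : ℝ) : ‖Complex.exp (a * b * Complex.I)‖ = 1 := by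
  rw [← Complex.ofReal_mul, Complex.norm_exp_ofReal_mul_I]

lemma integrable_smul_unit {α : Type*} [MeasurableSpace α] {ν : Measure α} {f : α → ℝ} {g : α → ℂ}
    (hf : Integrable f ν) (hg : AEStronglyMeasurable g ν) (h1 : ∀ x, ‖g x‖ = 1) :
    Integrable (fun x => f x • g x) ν :=
  hf.norm.mono' (hf.aestronglyMeasurable.smul hg) (ae_of_all _ fun x => by
    rw [norm_smul, h1, mul_one])

/-- The mean of one summand of the quadratic form against the characters of the quadratic form, by
a Taylor expansion in one coordinate. -/
lemma norm_integral_halfIncr_sub_le (hμ : ∀ i, IsNoiseLaw μ₄ m (μ i)) {M : Matrix ι ι ℝ}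
    (hM : M.IsSymm) {κ : ℝ} (hκ : OneNormLE M κ) (j : ι) (t : ℝ) :
    ‖(∫ x, halfIncr M x j • Complex.exp (t * centeredQuad M x * Complex.I) ∂(Measure.pi μ)) -
      (t * Complex.I) * ∫ x, condCov (fun i => ∫ z, z ^ 3 ∂(μ i)) μ₄ M x j •
        Complex.exp (t * centeredQuad M x * Complex.I) ∂(Measure.pi μ)‖ ≤
      t ^ 2 * (9 * (1 + m)) * (18 * (1 + m) * κ ^ 3) := by
  have := fun i => (hμ i).isProbabilityMeasure
  have hm := (hμ j).sixth_nonneg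
  set μ₃ := fun i => ∫ z, z ^ 3 ∂(μ i) with hμ₃
  have hb3 : ∀ i, |μ₃ i| ≤ 1 + m := fun i => (hμ i).abs_integral_pow_le (by norm_num)
  have hb4 : |μ₄| ≤ 1 + m := by
    rw [← (hμ j).fourth]; exact (hμ j).abs_integral_pow_le (by norm_num)
  let e : (ι → ℝ) → ℂ := fun x => Complex.exp (t * centeredQuad M x * Complex.I)
  let h : (ι → ℝ) → ℂ := fun y => Complex.exp (t * (centeredQuad M y + M j j : ℝ) * Complex.I)
  let V : (ι → ℝ) → ℝ := fun x => condCov μ₃ μ₄ M x j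
  let h₀ : (ι → ℝ) → ℂ := fun x => h (Function.update x j 0)
  have ce : Continuous e := by fun_prop
  have ch : Continuous h := by fun_prop
  have ch0 : Continuous h₀ := ch.comp (by fun_prop)
  have ne : ∀ x, ‖e x‖ = 1 := fun x => norm_exp_ofReal_mul_ofReal_mul_I _ _
  have nh : ∀ x, ‖h₀ x‖ = 1 := fun x => norm_exp_ofReal_mul_ofReal_mul_I _ _
  -- The character splits into `h₀`, which ignores coordinate `j`, and the character of the
  -- increment, which is expanded below.
  have heq : ∀ x, e x = h₀ x * Complex.exp ((t * incr M x j : ℝ) * Complex.I) := fun x => by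
    simp only [e, h₀, h, ← Complex.exp_add]
    congr 1
    rw [centeredQuad_eq_add_incr hM x j]
    push_cast
    ring
  have mX : MemLp (fun x => halfIncr M x j) 2 (Measure.pi μ) :=
    memLp_of_abs_le_colBound hμ (continuous_halfIncr M j) fun x => abs_halfIncr_le hM x j
  have mD : MemLp (fun x => incr M x j) 2 (Measure.pi μ) :=
    memLp_of_abs_le_colBound hμ (continuous_incr M j) fun x => abs_incr_le hM x j
  have mR : MemLp (fun x => rest M x j) 2 (Measure.pi μ) :=
    memLp_of_abs_le_colBound hμ (continuous_rest M j) fun x => abs_rest_le hM x j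
  have iX : Integrable (fun x => halfIncr M x j) (Measure.pi μ) := mX.integrable (by norm_num)
  have iXD : Integrable (fun x => halfIncr M x j * incr M x j) (Measure.pi μ) :=
    mX.integrable_mul mD
  have iV : Integrable V (Measure.pi μ) :=
    ((integrable_colBound_sq hμ M j).const_mul (4 * (1 + m) + 3)).mono'
      (continuous_condCov μ₃ μ₄ M j).aestronglyMeasurable
      (ae_of_all _ fun x => abs_condCov_le hM hb3 hb4 x j)
  have ih : Integrable h₀ (Measure.pi μ) :=
    (integrable_const (1 : ℝ)).mono' ch0.aestronglyMeasurable (ae_of_all _ fun x => (nh x).le)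
  have z1 : ∫ x, halfIncr M x j • h₀ x ∂(Measure.pi μ) = 0 :=
    integral_halfIncr_smul hμ M j ch.stronglyMeasurable ih
      (integrable_smul_unit (mR.integrable (by norm_num)) ch0.aestronglyMeasurable nh)
  have z2 : ∫ x, (halfIncr M x j * incr M x j - V x) • h₀ x ∂(Measure.pi μ) = 0 :=
    integral_halfIncr_mul_incr_smul hμ M j ch.stronglyMeasurable ih
      (integrable_smul_unit (mR.integrable (by norm_num)) ch0.aestronglyMeasurable nh)
      (integrable_smul_unit mR.integrable_sq ch0.aestronglyMeasurable nh)
  have i1 := integrable_smul_unit iX ce.aestronglyMeasurable ne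
  have i2 := (integrable_smul_unit iV ce.aestronglyMeasurable ne).const_mul (t * Complex.I)
  have i3 := integrable_smul_unit iX ch0.aestronglyMeasurable nh
  have i4 := (integrable_smul_unit (iXD.sub iV) ch0.aestronglyMeasurable nh).const_mul
    (t * Complex.I)
  -- The zeroth-order term of the first integrand and the combined first-order terms integrate to
  -- zero by `z1` and `z2`, so they may be subtracted for free.
  have hsplit : (∫ x, halfIncr M x j • e x ∂(Measure.pi μ)) -
      (t * Complex.I) * ∫ x, V x • e x ∂(Measure.pi μ) =
      ∫ x, ((halfIncr M x j • e x - (t * Complex.I) * (V x • e x)) - (halfIncr M x j • h₀ x +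
        (t * Complex.I) * ((halfIncr M x j * incr M x j - V x) • h₀ x))) ∂(Measure.pi μ) := by
    have a1 := integral_sub i1 i2
    have a2 := integral_add i3 i4
    have a3 := integral_sub (i1.sub i2) (i3.add i4)
    simp only [Pi.sub_apply, Pi.add_apply] at a1 a2 a3
    rw [a3, a1, a2, integral_const_mul, integral_const_mul, z1, z2]
    simp
  have hfin : ‖∫ x, ((halfIncr M x j • e x - (t * Complex.I) * (V x • e x)) -
      (halfIncr M x j • h₀ x + (t * Complex.I) * ((halfIncr M x j * incr M x j - V x) • h₀ x)))
        ∂(Measure.pi μ)‖ ≤ ∫ x, t ^ 2 * (9 * (1 + m)) * colBound M x j ^ 3 ∂(Measure.pi μ) := by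
    refine norm_integral_le_of_norm_le ((integrable_colBound_pow_three hμ M j).const_mul _)
      (ae_of_all _ fun x => ?_)
    have hc := colBound_nonneg M x j
    have hX := abs_halfIncr_le hM x j
    have hD := abs_incr_le hM x j
    have hV : |V x| ≤ _ := abs_condCov_le hM hb3 hb4 x j
    set E := Complex.exp ((t * incr M x j : ℝ) * Complex.I) with hE
    -- After the subtraction there remain `halfIncr` times a second-order Taylor remainder and `V`
    -- times a first-order one, both cubic in `colBound`.
    have e1 : (halfIncr M x j • e x - (t * Complex.I) * (V x • e x)) - (halfIncr M x j • h₀ x +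
        (t * Complex.I) * ((halfIncr M x j * incr M x j - V x) • h₀ x)) =
        (halfIncr M x j : ℂ) * h₀ x * (E - 1 - (t * incr M x j : ℝ) * Complex.I) -
        (t * Complex.I) * V x * h₀ x * (E - 1) := by
      rw [heq, ← hE]
      simp only [Complex.real_smul]
      push_cast
      ring
    rw [e1]
    refine (norm_sub_le _ _).trans ?_
    rw [norm_mul, norm_mul, norm_mul, norm_mul, norm_mul, nh, norm_mul, Complex.norm_I,
      Complex.norm_real, Complex.norm_real, Complex.norm_real, Real.norm_eq_abs, Real.norm_eq_abs,
      Real.norm_eq_abs, mul_one, mul_one, mul_one]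
    have b1 : ‖E - 1 - (t * incr M x j : ℝ) * Complex.I‖ ≤ 2 * (t ^ 2 * colBound M x j ^ 2) := by
      refine (norm_exp_mul_I_sub_one_sub_le _).trans ?_
      rw [mul_pow, ← sq_abs (incr M x j)]
      gcongr
    have b2 : ‖E - 1‖ ≤ |t| * colBound M x j := by
      refine (norm_exp_mul_I_sub_one_le _).trans ?_
      rw [abs_mul]
      gcongr
    calc |halfIncr M x j| * ‖E - 1 - (t * incr M x j : ℝ) * Complex.I‖ + |t| * |V x| * ‖E - 1‖
        ≤ colBound M x j * (2 * (t ^ 2 * colBound M x j ^ 2)) +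
          |t| * ((4 * (1 + m) + 3) * colBound M x j ^ 2) * (|t| * colBound M x j) := by gcongr
      -- The constant is `2 + (4 (1 + m) + 3) = 9 + 4m`.
      _ = t ^ 2 * (9 + 4 * m) * colBound M x j ^ 3 := by rw [← sq_abs t]; ring
      _ ≤ _ := by
        have : 9 + 4 * m ≤ 9 * (1 + m) := by linarith
        gcongr
  refine (congrArg norm hsplit).trans_le (hfin.trans ?_)
  rw [integral_const_mul]
  exact mul_le_mul_of_nonneg_left (integral_colBound_pow_three_le hμ hκ j) (by positivity)

/-- Nonnegativity of the variance of `|f|`. -/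
lemma integral_abs_le_sqrt {α : Type*} [MeasurableSpace α] {ν : Measure α} [IsProbabilityMeasure ν]
    {f : α → ℝ} (hf : MemLp f 2 ν) {B : ℝ} (h : ∫ x, f x ^ 2 ∂ν ≤ B) : ∫ x, |f x| ∂ν ≤ √B := by
  refine Real.le_sqrt_of_sq_le (le_trans ?_ h)
  have h1 := variance_eq_sub hf.abs
  have h2 := variance_nonneg (fun x => |f x|) ν
  have e : ∫ x, ((fun x => |f x|) ^ 2) x ∂ν = ∫ x, f x ^ 2 ∂ν := by simp
  have h1' : Var[fun x => |f x|; ν] = ∫ x, f x ^ 2 ∂ν - (∫ x, |f x| ∂ν) ^ 2 := by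
    rw [← e]; exact h1
  linarith

/-- The differential inequality for the characteristic function of a quadratic form. -/
lemma norm_integral_centeredQuad_smul_exp_sub_le (hμ : ∀ i, IsNoiseLaw μ₄ m (μ i))
    {M : Matrix ι ι ℝ} (hM : M.IsSymm) {κ : ℝ} (hκ : OneNormLE M κ) (hm : 0 ≤ m) (t : ℝ) :
    ‖(∫ x, centeredQuad M x • Complex.exp (t * centeredQuad M x * Complex.I) ∂(Measure.pi μ)) -
      (t * Complex.I) * (quadVar μ₄ M *
        ∫ x, Complex.exp (t * centeredQuad M x * Complex.I) ∂(Measure.pi μ))‖ ≤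
      Fintype.card ι * (t ^ 2 * (9 * (1 + m)) * (18 * (1 + m) * κ ^ 3)) +
        |t| * √(Fintype.card ι * (162 * (1 + m) ^ 2 * κ ^ 4)) := by
  have := fun i => (hμ i).isProbabilityMeasure
  rcases isEmpty_or_nonempty ι with hι | ⟨⟨j₀⟩⟩
  · simp [centeredQuad, quadVar, Matrix.trace]
  set μ₃ := fun i => ∫ z, z ^ 3 ∂(μ i) with hμ₃
  have hb3 : ∀ i, |μ₃ i| ≤ 1 + m := fun i => (hμ i).abs_integral_pow_le (by norm_num)
  have hb4 : |μ₄| ≤ 1 + m := by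
    rw [← (hμ j₀).fourth]; exact (hμ j₀).abs_integral_pow_le (by norm_num)
  let e : (ι → ℝ) → ℂ := fun x => Complex.exp (t * centeredQuad M x * Complex.I)
  have ce : Continuous e := by fun_prop
  have ne : ∀ x, ‖e x‖ = 1 := fun x => norm_exp_ofReal_mul_ofReal_mul_I _ _
  have iX : ∀ j, Integrable (fun x => halfIncr M x j • e x) (Measure.pi μ) := fun j =>
    integrable_smul_unit ((memLp_of_abs_le_colBound hμ (continuous_halfIncr M j) fun x =>
      abs_halfIncr_le hM x j).integrable (by norm_num)) ce.aestronglyMeasurable ne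
  have iV : ∀ j, Integrable (fun x => condCov μ₃ μ₄ M x j • e x) (Measure.pi μ) := fun j =>
    integrable_smul_unit (((integrable_colBound_sq hμ M j).const_mul (4 * (1 + m) + 3)).mono'
      (continuous_condCov μ₃ μ₄ M j).aestronglyMeasurable
      (ae_of_all _ fun x => abs_condCov_le hM hb3 hb4 x j)) ce.aestronglyMeasurable ne
  have ie : Integrable e (Measure.pi μ) :=
    (integrable_const (1 : ℝ)).mono' ce.aestronglyMeasurable (ae_of_all _ fun x => (ne x).le)
  obtain ⟨hL, hv⟩ := integral_sum_condCov_sub_sq_le hμ hM hκ hm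
  have s1 : ∫ x, centeredQuad M x • e x ∂(Measure.pi μ) =
      ∑ j, ∫ x, halfIncr M x j • e x ∂(Measure.pi μ) := by
    rw [← integral_finsetSum _ fun j _ => iX j]
    simp only [← Finset.sum_smul, sum_halfIncr]
  have s2 : ∫ x, (∑ j, condCov μ₃ μ₄ M x j - quadVar μ₄ M) • e x ∂(Measure.pi μ) =
      (∑ j, ∫ x, condCov μ₃ μ₄ M x j • e x ∂(Measure.pi μ)) -
        quadVar μ₄ M * ∫ x, e x ∂(Measure.pi μ) := by
    rw [← integral_finsetSum _ fun j _ => iV j, ← integral_const_mul,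
      ← integral_sub (integrable_finsetSum _ fun j _ => iV j) (ie.const_mul _)]
    congr 1 with x
    rw [sub_smul, Finset.sum_smul, Complex.real_smul (x := quadVar μ₄ M)]
  -- Two sources of error: the Taylor remainders, summed over the coordinates, and the replacement
  -- of the random `∑ condCov` by the constant `quadVar`.
  have hfin : (∫ x, centeredQuad M x • e x ∂(Measure.pi μ)) -
      (t * Complex.I) * (quadVar μ₄ M * ∫ x, e x ∂(Measure.pi μ)) =
      (∑ j, ((∫ x, halfIncr M x j • e x ∂(Measure.pi μ)) -
        (t * Complex.I) * ∫ x, condCov μ₃ μ₄ M x j • e x ∂(Measure.pi μ))) +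
      (t * Complex.I) *
        ∫ x, (∑ j, condCov μ₃ μ₄ M x j - quadVar μ₄ M) • e x ∂(Measure.pi μ) := by
    rw [s1, s2, Finset.sum_sub_distrib, ← Finset.mul_sum]
    ring
  refine (congrArg norm hfin).trans_le ((norm_add_le _ _).trans (add_le_add ?_ ?_))
  · refine (norm_sum_le _ _).trans ((Finset.sum_le_sum fun j _ =>
      norm_integral_halfIncr_sub_le hμ hM hκ j t).trans_eq ?_)
    simp
  · rw [norm_mul, norm_mul, Complex.norm_I, Complex.norm_real, Real.norm_eq_abs, mul_one]
    refine mul_le_mul_of_nonneg_left ?_ (abs_nonneg t)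
    refine le_trans ?_ (integral_abs_le_sqrt hL hv)
    refine norm_integral_le_of_norm_le (hL.integrable (by norm_num)).abs (ae_of_all _ fun x => ?_)
    rw [norm_smul, ne, mul_one, Real.norm_eq_abs]

lemma hasDerivAt_integral_exp {α : Type*} [MeasurableSpace α] {ν : Measure α}
    [IsProbabilityMeasure ν] {f : α → ℝ} (hf : Integrable f ν) (t : ℝ) :
    HasDerivAt (fun t : ℝ => ∫ x, Complex.exp (t * f x * Complex.I) ∂ν)
      (Complex.I * ∫ x, f x • Complex.exp (t * f x * Complex.I) ∂ν) t := by
  have hmeas : ∀ t : ℝ, AEStronglyMeasurable (fun x => Complex.exp (t * f x * Complex.I)) ν :=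
    fun t => by
      have h := hf.aestronglyMeasurable
      have hc : Continuous fun z : ℝ => Complex.exp (t * z * Complex.I) := by fun_prop
      exact hc.comp_aestronglyMeasurable h
  rw [← integral_const_mul]
  refine (hasDerivAt_integral_of_dominated_loc_of_deriv_le (bound := fun x => |f x|)
    (F' := fun t x => Complex.I * f x • Complex.exp (t * f x * Complex.I))
    Filter.univ_mem (Eventually.of_forall hmeas) ?_ ?_ ?_ hf.abs ?_).2
  · exact (integrable_const (1 : ℝ)).mono' (hmeas t)
      (ae_of_all _ fun x => (norm_exp_ofReal_mul_ofReal_mul_I _ _).le)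
  · exact (hf.aestronglyMeasurable.smul (hmeas t)).const_mul _
  · refine ae_of_all _ fun x s _ => ?_
    rw [norm_mul, norm_smul, norm_exp_ofReal_mul_ofReal_mul_I, Complex.norm_I, one_mul, mul_one,
      Real.norm_eq_abs]
  · refine ae_of_all _ fun x s _ => ?_
    have h1 : HasDerivAt (fun s : ℝ => (s : ℂ) * f x * Complex.I) (1 * f x * Complex.I) s :=
      ((Complex.ofRealCLM.hasDerivAt (x := s)).mul_const _).mul_const _
    refine h1.cexp.congr_deriv ?_
    rw [Complex.real_smul]
    ring

/-- A quantitative central limit theorem for quadratic forms, in terms of the bound `κ` for the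
column sums of the matrix. -/
theorem norm_charFun_centeredQuad_sub_le (hμ : ∀ i, IsNoiseLaw μ₄ m (μ i))
    {M : Matrix ι ι ℝ} (hM : M.IsSymm) {κ : ℝ} (hκ : OneNormLE M κ) (hκ0 : 0 ≤ κ) (hm : 0 ≤ m) :
    ‖(∫ x, Complex.exp (centeredQuad M x * Complex.I) ∂(Measure.pi μ)) -
      Complex.exp (-(quadVar μ₄ M / 2 : ℝ))‖ ≤
      (Fintype.card ι * ((9 * (1 + m)) * (18 * (1 + m) * κ ^ 3)) +
        √(Fintype.card ι * (162 * (1 + m) ^ 2 * κ ^ 4))) * Real.exp |quadVar μ₄ M| := by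
  have := fun i => (hμ i).isProbabilityMeasure
  set v := quadVar μ₄ M with hv
  set ε := Fintype.card ι * ((9 * (1 + m)) * (18 * (1 + m) * κ ^ 3)) +
        √(Fintype.card ι * (162 * (1 + m) ^ 2 * κ ^ 4)) with hε
  have hε0 : 0 ≤ ε := by positivity
  let φ : ℝ → ℂ := fun t => ∫ x, Complex.exp (t * centeredQuad M x * Complex.I) ∂(Measure.pi μ)
  let D : ℝ → ℂ := fun t =>
    ∫ x, centeredQuad M x • Complex.exp (t * centeredQuad M x * Complex.I) ∂(Measure.pi μ)
  have hφ : ∀ t, HasDerivAt φ (Complex.I * D t) t := fun t =>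
    hasDerivAt_integral_exp ((memLp_centeredQuad hμ hM).integrable (by norm_num)) t
  have hg : ∀ t : ℝ, HasDerivAt (fun t : ℝ => Complex.exp ((v / 2 * t ^ 2 : ℝ)))
      (Complex.exp ((v / 2 * t ^ 2 : ℝ)) * (v * t : ℝ)) t := fun t => by
    have h1 : HasDerivAt (fun t : ℝ => v / 2 * t ^ 2) (v * t) t := by
      refine ((hasDerivAt_pow 2 t).const_mul (v / 2)).congr_deriv ?_
      push_cast
      ring
    exact h1.ofReal_comp.cexp
  -- The integrating factor `exp(v t² / 2)` of `φ' = -t v φ`: the derivative of this product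
  -- consists of the error term alone.
  have hψ : ∀ t, HasDerivAt (fun t : ℝ => φ t * Complex.exp ((v / 2 * t ^ 2 : ℝ)))
      (Complex.I * D t * Complex.exp ((v / 2 * t ^ 2 : ℝ)) +
        φ t * (Complex.exp ((v / 2 * t ^ 2 : ℝ)) * (v * t : ℝ))) t := fun t => (hφ t).mul (hg t)
  have key := norm_image_sub_le_of_norm_deriv_le_segment_01' (C := ε * Real.exp (|v| / 2))
    (fun t _ => (hψ t).hasDerivWithinAt) (fun t ht => by
      have e1 : Complex.I * D t * Complex.exp ((v / 2 * t ^ 2 : ℝ)) +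
          φ t * (Complex.exp ((v / 2 * t ^ 2 : ℝ)) * (v * t : ℝ)) =
          Complex.I * (D t - (t * Complex.I) * (v * φ t)) *
            Complex.exp ((v / 2 * t ^ 2 : ℝ)) := by
        push_cast
        linear_combination ((Complex.exp (v / 2 * t ^ 2) * t * v * φ t)) * Complex.I_sq
      rw [e1, norm_mul, norm_mul, Complex.norm_I, one_mul, Complex.norm_exp, Complex.ofReal_re]
      have ht1 : |t| ≤ 1 := by rw [abs_of_nonneg ht.1]; exact ht.2.le
      have ht2 : t ^ 2 ≤ 1 := by rw [← sq_abs]; exact pow_le_one₀ (abs_nonneg t) ht1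
      refine mul_le_mul ?_ ?_ (Real.exp_pos _).le hε0
      · refine (norm_integral_centeredQuad_smul_exp_sub_le hμ hM hκ hm t).trans ?_
        refine add_le_add (mul_le_mul_of_nonneg_left ?_ (Nat.cast_nonneg _))
          (mul_le_of_le_one_left (Real.sqrt_nonneg _) ht1)
        rw [mul_assoc]
        exact mul_le_of_le_one_left (by positivity) ht2
      · refine Real.exp_le_exp.2 ((le_abs_self _).trans ?_)
        rw [abs_mul, abs_div, abs_of_pos (by norm_num : (0 : ℝ) < 2), abs_of_nonneg (sq_nonneg t)]
        exact mul_le_of_le_one_right (by positivity) ht2)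
  have h0 : φ 0 = 1 := by simp [φ]
  have h1 : φ 1 = ∫ x, Complex.exp (centeredQuad M x * Complex.I) ∂(Measure.pi μ) := by simp [φ]
  simp only [h0, h1, one_pow, mul_one, ne_eq, OfNat.ofNat_ne_zero, not_false_eq_true, zero_pow,
    mul_zero, Complex.ofReal_zero, Complex.exp_zero] at key
  set I₁ := ∫ x, Complex.exp (centeredQuad M x * Complex.I) ∂(Measure.pi μ) with hI
  have e2 : I₁ - Complex.exp (-(v / 2 : ℝ)) =
      (I₁ * Complex.exp ((v / 2 : ℝ)) - 1) * Complex.exp (-(v / 2 : ℝ)) := by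
    rw [sub_mul, mul_assoc, ← Complex.exp_add, add_neg_cancel, Complex.exp_zero, mul_one, one_mul]
  rw [e2, norm_mul, ← Complex.ofReal_neg, Complex.norm_exp, Complex.ofReal_re]
  -- One factor `exp(|v|/2)` bounds the integrating factor, the other comes from dividing by it at
  -- `t = 1`. The absolute value makes the sign of `v` irrelevant.
  calc _ ≤ (ε * Real.exp (|v| / 2)) * Real.exp (|v| / 2) := by
        refine mul_le_mul key (Real.exp_le_exp.2 ?_) (Real.exp_pos _).le (by positivity)
        linarith [neg_abs_le v]
    _ = ε * Real.exp |v| := by rw [mul_assoc, ← Real.exp_add, add_halves]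

end CharFun

/-! ### Matrix inequalities and linear combinations of quadratic forms -/

section Linear

variable {ι κ : Type*} [Fintype ι] [Fintype κ]

lemma frobNorm_sq {m n : Type*} [Fintype m] [Fintype n] (M : Matrix m n ℝ) :
    frobNorm M ^ 2 = ∑ i, ∑ j, M i j ^ 2 :=
  Real.sq_sqrt (Finset.sum_nonneg fun _ _ => Finset.sum_nonneg fun _ _ => sq_nonneg _)

lemma frobNorm_nonneg {m n : Type*} [Fintype m] [Fintype n] (M : Matrix m n ℝ) : 0 ≤ frobNorm M :=
  Real.sqrt_nonneg _

lemma dotProduct_self_nonneg_real (a : ι → ℝ) : 0 ≤ a ⬝ᵥ a :=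
  Finset.sum_nonneg fun i _ => mul_self_nonneg (a i)

lemma dotProduct_sq_le (a b : ι → ℝ) : (a ⬝ᵥ b) ^ 2 ≤ (a ⬝ᵥ a) * (b ⬝ᵥ b) := by
  simpa only [dotProduct, sq] using Finset.sum_mul_sq_le_sq_mul_sq Finset.univ a b

lemma mulVec_dotProduct_self_le (E : Matrix ι κ ℝ) (a : κ → ℝ) :
    E.mulVec a ⬝ᵥ E.mulVec a ≤ frobNorm E ^ 2 * (a ⬝ᵥ a) := by
  rw [frobNorm_sq, dotProduct, Finset.sum_mul]
  refine Finset.sum_le_sum fun i _ => ?_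
  have := dotProduct_sq_le (E i) a
  simp only [dotProduct, ← sq] at this ⊢
  simpa only [Matrix.mulVec, dotProduct] using this

lemma abs_dotProduct_mulVec_le (E : Matrix ι κ ℝ) (b : ι → ℝ) (a : κ → ℝ) :
    |b ⬝ᵥ E.mulVec a| ≤ frobNorm E * (√(b ⬝ᵥ b) * √(a ⬝ᵥ a)) := by
  refine abs_le_of_sq_le_sq ?_ (mul_nonneg (frobNorm_nonneg E) (by positivity))
  rw [mul_pow, mul_pow, Real.sq_sqrt (dotProduct_self_nonneg_real b),
    Real.sq_sqrt (dotProduct_self_nonneg_real a)]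
  calc _ ≤ (b ⬝ᵥ b) * (E.mulVec a ⬝ᵥ E.mulVec a) := dotProduct_sq_le _ _
    _ ≤ (b ⬝ᵥ b) * (frobNorm E ^ 2 * (a ⬝ᵥ a)) :=
        mul_le_mul_of_nonneg_left (mulVec_dotProduct_self_le E a) (dotProduct_self_nonneg_real b)
    _ = _ := by ring

lemma posSemidef_sub_smul_one [DecidableEq ι] {M : Matrix ι ι ℝ} (hM : M.IsSymm) {τ : ℝ}
    (h : LeMinEig τ M) : (M - τ • (1 : Matrix ι ι ℝ)).PosSemidef := by
  refine Matrix.posSemidef_iff_isHermitian_and_spectrum_nonneg.2 ⟨?_, fun a ha => ?_⟩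
  · refine Matrix.IsHermitian.sub ?_ ?_
    · rw [Matrix.IsHermitian, Matrix.conjTranspose_eq_transpose_of_trivial]; exact hM
    · simp [Matrix.IsHermitian]
  · have : a + τ ∈ spectrum ℝ M := by
      rw [← Algebra.algebraMap_eq_smul_one] at ha
      rw [spectrum.mem_iff] at ha ⊢
      intro hu
      apply ha
      convert hu using 1
      rw [map_add]
      abel
    have := h _ this
    simp only [Set.mem_ofPred_eq]
    linarith

lemma LeMinEig.le_dotProduct [DecidableEq ι] {M : Matrix ι ι ℝ} (hM : M.IsSymm) {τ : ℝ}
    (h : LeMinEig τ M) (x : ι → ℝ) : τ * (x ⬝ᵥ x) ≤ x ⬝ᵥ M.mulVec x := by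
  have := (posSemidef_sub_smul_one hM h).dotProduct_mulVec_nonneg x
  simp only [star_trivial, Matrix.sub_mulVec, Matrix.smul_mulVec, Matrix.one_mulVec,
    dotProduct_sub, dotProduct_smul, smul_eq_mul] at this
  linarith

/-- Cauchy-Schwarz: `τ ‖x‖² ≤ x · M x ≤ ‖x‖ ‖M x‖`. -/
lemma LeMinEig.dotProduct_self_le [DecidableEq ι] {M : Matrix ι ι ℝ} (hM : M.IsSymm) {τ : ℝ}
    (hτ : 0 < τ) (h : LeMinEig τ M) (x : ι → ℝ) :
    x ⬝ᵥ x ≤ τ⁻¹ ^ 2 * (M.mulVec x ⬝ᵥ M.mulVec x) := by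
  have h1 := h.le_dotProduct hM x
  have h2 := dotProduct_sq_le x (M.mulVec x)
  have h3 := dotProduct_self_nonneg_real x
  have h4 := dotProduct_self_nonneg_real (M.mulVec x)
  have h5 : τ ^ 2 * (x ⬝ᵥ x) ^ 2 ≤ (x ⬝ᵥ x) * (M.mulVec x ⬝ᵥ M.mulVec x) := by
    refine le_trans ?_ h2
    rw [← mul_pow]
    exact pow_le_pow_left₀ (by positivity) h1 2
  rcases h3.eq_or_lt with h0 | h0
  · rw [← h0]; positivity
  · rw [inv_pow, ← div_eq_inv_mul, le_div_iff₀ (by positivity)]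
    nlinarith

lemma LeMinEig.isUnit_det [DecidableEq ι] {M : Matrix ι ι ℝ} {τ : ℝ} (hτ : 0 < τ)
    (h : LeMinEig τ M) : IsUnit M.det := by
  rw [← Matrix.isUnit_iff_isUnit_det]
  by_contra hu
  have := h 0 (spectrum.zero_mem_iff ℝ |>.2 hu)
  linarith

lemma LeMinEig.posSemidef [DecidableEq ι] {M : Matrix ι ι ℝ} (hM : M.IsSymm) {τ : ℝ} (hτ : 0 < τ)
    (h : LeMinEig τ M) : M.PosSemidef := by
  refine Matrix.PosSemidef.of_dotProduct_mulVec_nonneg ?_ fun x => ?_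
  · rw [Matrix.IsHermitian, Matrix.conjTranspose_eq_transpose_of_trivial]; exact hM
  · have := h.le_dotProduct hM x
    rw [star_trivial]
    exact (mul_nonneg hτ.le (dotProduct_self_nonneg_real x)).trans this

/-- By duality: for `a = uᵀ A` one has `‖a‖² = u · A a ≤ ‖u‖ ‖A‖ ‖a‖`. -/
lemma vecMul_dotProduct_self_le [DecidableEq ι] [DecidableEq κ] (A : Matrix ι κ ℝ) (u : ι → ℝ) :
    Matrix.vecMul u A ⬝ᵥ Matrix.vecMul u A ≤ opNorm A ^ 2 * (u ⬝ᵥ u) := by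
  have h1 : ∀ v : κ → ℝ, A.mulVec v ⬝ᵥ A.mulVec v ≤ opNorm A ^ 2 * (v ⬝ᵥ v) := fun v => by
    have h := Matrix.l2_opNorm_mulVec A (WithLp.toLp 2 v)
    have h2 := pow_le_pow_left₀ (norm_nonneg _) h 2
    rw [mul_pow, EuclideanSpace.real_norm_sq_eq, EuclideanSpace.real_norm_sq_eq] at h2
    simp only [dotProduct, ← sq]
    exact h2
  set a := Matrix.vecMul u A with ha
  have h2 : a ⬝ᵥ a = u ⬝ᵥ A.mulVec a := by
    rw [Matrix.dotProduct_mulVec, ← ha]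
  have h3 := dotProduct_sq_le u (A.mulVec a)
  have h4 := h1 a
  have h5 := dotProduct_self_nonneg_real u
  have h6 := dotProduct_self_nonneg_real a
  rw [← h2] at h3
  rcases h6.eq_or_lt with h0 | h0
  · rw [← h0]; positivity
  · have : (a ⬝ᵥ a) * (a ⬝ᵥ a) ≤ (a ⬝ᵥ a) * (opNorm A ^ 2 * (u ⬝ᵥ u)) := by
      nlinarith [mul_le_mul_of_nonneg_left h4 h5]
    exact le_of_mul_le_mul_left this h0

lemma oneNormLE_sum_smul {B : κ → Matrix ι ι ℝ} {b : ℝ} (hB : ∀ k, OneNormLE (B k) b) (a : κ → ℝ) :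
    OneNormLE (∑ k, a k • B k) ((∑ k, |a k|) * b) := fun j => by
  calc ∑ i, |(∑ k, a k • B k) i j| ≤ ∑ i, ∑ k, |a k| * |B k i j| := by
        refine Finset.sum_le_sum fun i _ => ?_
        rw [Matrix.sum_apply]
        refine (Finset.abs_sum_le_sum_abs _ _).trans_eq (Finset.sum_congr rfl fun k _ => ?_)
        rw [Matrix.smul_apply, smul_eq_mul, abs_mul]
    _ = ∑ k, |a k| * ∑ i, |B k i j| := by
        rw [Finset.sum_comm]; simp_rw [Finset.mul_sum]
    _ ≤ ∑ k, |a k| * b :=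
        Finset.sum_le_sum fun k _ => mul_le_mul_of_nonneg_left (hB k j) (abs_nonneg _)
    _ = _ := by rw [Finset.sum_mul]

lemma centeredQuad_sum_smul (B : κ → Matrix ι ι ℝ) (a : κ → ℝ) (x : ι → ℝ) :
    centeredQuad (∑ k, a k • B k) x = a ⬝ᵥ fun k => centeredQuad (B k) x := by
  simp only [centeredQuad, Matrix.sum_mulVec, Matrix.smul_mulVec, dotProduct_sum, dotProduct_smul,
    Matrix.trace_sum, Matrix.trace_smul, smul_eq_mul]
  simp only [dotProduct, mul_sub, Finset.sum_sub_distrib]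

lemma quadVar_sum_smul (μ₄ : ℝ) (B : κ → Matrix ι ι ℝ) (a : κ → ℝ) :
    quadVar μ₄ (∑ k, a k • B k) = a ⬝ᵥ (Matrix.of fun k l => 2 * (B k * B l).trace +
      (μ₄ - 3) * (Matrix.hadamard (B k) (B l)).trace).mulVec a := by
  have h1 : ((∑ k, a k • B k) * (∑ k, a k • B k)).trace =
      ∑ k, ∑ l, a k * a l * (B k * B l).trace := by
    rw [Finset.sum_mul_sum, Matrix.trace_sum]
    refine Finset.sum_congr rfl fun k _ => ?_
    rw [Matrix.trace_sum]
    refine Finset.sum_congr rfl fun l _ => ?_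
    rw [smul_mul_smul_comm, Matrix.trace_smul, smul_eq_mul]
  have h2 : ∑ j, (∑ k, a k • B k) j j ^ 2 =
      ∑ k, ∑ l, a k * a l * (Matrix.hadamard (B k) (B l)).trace := by
    simp only [Matrix.trace, Matrix.diag, Matrix.hadamard_apply, Finset.mul_sum]
    have : ∀ j, (∑ k, a k • B k) j j ^ 2 = ∑ k, ∑ l, a k * a l * (B k j j * B l j j) := fun j => by
      rw [Matrix.sum_apply, sq, Finset.sum_mul_sum]
      exact Finset.sum_congr rfl fun k _ => Finset.sum_congr rfl fun l _ => by
        simp only [Matrix.smul_apply, smul_eq_mul]; ring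
    simp only [this]
    rw [Finset.sum_comm]
    exact Finset.sum_congr rfl fun k _ => Finset.sum_comm
  rw [quadVar, h1, h2]
  simp only [dotProduct, Matrix.mulVec, Matrix.of_apply, Finset.mul_sum, ← Finset.sum_add_distrib]
  exact Finset.sum_congr rfl fun k _ => Finset.sum_congr rfl fun l _ => by ring

end Linear

/-! ### The covariance model and the normal equations -/

section Model

variable {p K : ℕ} {W : Fin (K + 1) → Matrix (Fin p) (Fin p) ℝ} {β : Fin (K + 1) → ℝ}

lemma cov_isSymm (hW : ∀ k, (W k).IsSymm) (b : Fin (K + 1) → ℝ) : (cov W b).IsSymm := by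
  rw [Matrix.IsSymm, cov, Matrix.transpose_sum]
  exact Finset.sum_congr rfl fun k _ => by rw [Matrix.transpose_smul, hW k]

open scoped MatrixOrder in
lemma covSqrt_mul_self (h : (cov W β).PosSemidef) : covSqrt W β * covSqrt W β = cov W β :=
  CFC.sqrt_mul_sqrt_self _ h.nonneg

open scoped MatrixOrder in
lemma covSqrt_isSymm : (covSqrt W β).IsSymm := by
  have h : (covSqrt W β).PosSemidef := Matrix.nonneg_iff_posSemidef.1 (CFC.sqrt_nonneg _)
  have := h.isHermitian
  rwa [Matrix.IsHermitian, Matrix.conjTranspose_eq_transpose_of_trivial] at this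

/-- `Σ₀^{1/2} Wₖ Σ₀^{1/2}`. -/
noncomputable def sandwich (W : Fin (K + 1) → Matrix (Fin p) (Fin p) ℝ) (β : Fin (K + 1) → ℝ)
    (k : Supp β) :
    Matrix (Fin p) (Fin p) ℝ :=
  covSqrt W β * W k.1 * covSqrt W β

lemma sandwich_isSymm (hW : ∀ k, (W k).IsSymm) (k : Supp β) : (sandwich W β k).IsSymm := by
  rw [Matrix.IsSymm, sandwich, Matrix.transpose_mul, Matrix.transpose_mul, covSqrt_isSymm, hW,
    Matrix.mul_assoc]

lemma oneNormLE_sandwich {w σ : ℝ} (hσ : 0 ≤ σ) (hw0 : 0 ≤ w) (hw : ∀ k, OneNormLE (W k) w)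
    (hC : OneNormLE (covSqrt W β) (√σ)) (k : Supp β) : OneNormLE (sandwich W β k) (σ * w) := by
  have h := (hC.mul (hw k.1) (Real.sqrt_nonneg σ)).mul hC (by positivity)
  have e : √σ * w * √σ = σ * w := by
    rw [mul_comm, ← mul_assoc, Real.mul_self_sqrt hσ]
  rwa [e] at h

lemma trace_sandwich_mul (h : (cov W β).PosSemidef) (k l : Supp β) :
    (sandwich W β k * sandwich W β l).trace =
      (cov W β ^ 1 * W k.1 * cov W β ^ 1 * W l.1).trace := by
  rw [pow_one, ← covSqrt_mul_self h, sandwich, sandwich]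
  set C := covSqrt W β
  calc _ = (C * (W k.1 * C * C * W l.1 * C)).trace := by simp only [Matrix.mul_assoc]
    _ = ((W k.1 * C * C * W l.1 * C) * C).trace := Matrix.trace_mul_comm _ _
    _ = ((W k.1 * C * C * W l.1) * (C * C)).trace := by simp only [Matrix.mul_assoc]
    _ = ((C * C) * (W k.1 * C * C * W l.1)).trace := Matrix.trace_mul_comm _ _
    _ = _ := by simp only [Matrix.mul_assoc]

/-- The variance of a combination of the quadratic forms of the sandwiched matrices. -/
lemma quadVar_sum_smul_sandwich (h : (cov W β).PosSemidef) (hp : (p : ℝ) ≠ 0) (μ₄ : ℝ)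
    (a : Supp β → ℝ) :
    quadVar μ₄ (∑ k, a k • sandwich W β k) =
      p * (a ⬝ᵥ ((2 : ℝ) • Gmat W β 1 + (μ₄ - 3) • Hmat W β).mulVec a) := by
  have e : (Matrix.of fun k l => 2 * (sandwich W β k * sandwich W β l).trace +
      (μ₄ - 3) * (Matrix.hadamard (sandwich W β k) (sandwich W β l)).trace) =
      (p : ℝ) • ((2 : ℝ) • Gmat W β 1 + (μ₄ - 3) • Hmat W β) := by
    ext k l
    simp only [Matrix.of_apply, Matrix.smul_apply, Matrix.add_apply, Gmat, Hmat, smul_eq_mul,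
      trace_sandwich_mul h]
    simp only [sandwich]
    field_simp
  rw [quadVar_sum_smul, e, Matrix.smul_mulVec, dotProduct_smul, smul_eq_mul]

lemma Gmat_zero : Gmat W β 0 = (p : ℝ)⁻¹ • gramS W β := by
  ext k l
  simp [Gmat, gramS]

lemma gramS_isSymm : (gramS W β).IsSymm := by
  ext k l
  simp only [gramS, Matrix.transpose_apply, Matrix.of_apply]
  exact Matrix.trace_mul_comm _ _

lemma Gmat_zero_isSymm : (Gmat W β 0).IsSymm := by
  rw [Gmat_zero, Matrix.IsSymm, Matrix.transpose_smul, gramS_isSymm]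

lemma cov_add_smul_single (b : Fin (K + 1) → ℝ) (k : Fin (K + 1)) (t : ℝ) :
    cov W (b + Pi.single k t) = cov W b + t • W k := by
  simp only [cov, Pi.add_apply, add_smul, Finset.sum_add_distrib]
  congr 1
  rw [Finset.sum_eq_single k]
  · simp
  · intro l _ hl; simp [hl]
  · simp

/-- First-order condition in a coordinate of the support, where perturbations stay admissible. The
loss changes by a positive multiple of `-2tc + t²q`, which must be nonnegative for all `t`. -/
lemma IsOracle.sum_residual_mul_eq_zero {y : Fin p → ℝ} {b : Fin (K + 1) → ℝ}
    (hb : IsOracle W β y b) (k : Supp β) :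
    ∑ i, ∑ j, (Matrix.vecMulVec y y - cov W b) i j * W k.1 i j = 0 := by
  rcases Nat.eq_zero_or_pos p with rfl | hp
  · simp
  set R := Matrix.vecMulVec y y - cov W b with hR
  set c := ∑ i, ∑ j, R i j * W k.1 i j with hc
  set q := ∑ i, ∑ j, W k.1 i j ^ 2 with hq
  have key : ∀ t : ℝ, 0 ≤ -2 * t * c + t ^ 2 * q := by
    intro t
    have hmem : b + Pi.single k.1 t ∈ supportedOn β := fun l hl => by
      have : l ≠ k.1 := fun h => k.2 (h ▸ hl)
      simp [this, hb.1 l hl]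
    have h := hb.2 hmem
    have hR' : Matrix.vecMulVec y y - cov W (b + Pi.single k.1 t) = R - t • W k.1 := by
      rw [cov_add_smul_single, hR]; abel
    simp only [Set.mem_ofPred_eq, loss, hR', ← hR] at h
    have h2 := le_of_mul_le_mul_left h (by positivity)
    rw [frobNorm_sq, frobNorm_sq] at h2
    have e : ∑ i, ∑ j, (R - t • W k.1) i j ^ 2 =
        ∑ i, ∑ j, R i j ^ 2 + (-2 * t * c + t ^ 2 * q) := by
      simp only [hc, hq, Finset.mul_sum, ← Finset.sum_add_distrib]
      refine Finset.sum_congr rfl fun i _ => Finset.sum_congr rfl fun j _ => ?_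
      simp only [Matrix.sub_apply, Matrix.smul_apply, smul_eq_mul]
      ring
    linarith
  have hq0 : 0 ≤ q := Finset.sum_nonneg fun _ _ => Finset.sum_nonneg fun _ _ => sq_nonneg _
  -- Close to the minimizer `c / q`, but meaningful also when `W k = 0`.
  have h1 := key (c / (q + 1))
  have e : -2 * (c / (q + 1)) * c + (c / (q + 1)) ^ 2 * q = -(c ^ 2 * (q + 2)) / (q + 1) ^ 2 := by
    field_simp; ring
  rw [e, le_div_iff₀ (by positivity), zero_mul] at h1
  have : c ^ 2 * (q + 2) = 0 := le_antisymm (by linarith) (by positivity)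
  rcases mul_eq_zero.1 this with h | h
  · exact pow_eq_zero_iff (two_ne_zero) |>.1 h
  · linarith

/-- The normal equations of the oracle estimator. -/
lemma IsOracle.gramS_mulVec {y : Fin p → ℝ} {b : Fin (K + 1) → ℝ} (hW : ∀ k, (W k).IsSymm)
    (hb : IsOracle W β y b) :
    (gramS W β).mulVec (fun k => b k.1 - β k.1) =
      fun k => y ⬝ᵥ (W k.1).mulVec y - (W k.1 * cov W β).trace := by
  ext k
  have h := hb.sum_residual_mul_eq_zero k
  have e1 : ∑ i, ∑ j, Matrix.vecMulVec y y i j * W k.1 i j = y ⬝ᵥ (W k.1).mulVec y := by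
    simp only [Matrix.vecMulVec_apply, dotProduct, Matrix.mulVec, Finset.mul_sum]
    exact Finset.sum_congr rfl fun i _ => Finset.sum_congr rfl fun j _ => by ring
  have e2 : ∀ N : Matrix (Fin p) (Fin p) ℝ, ∑ i, ∑ j, N i j * W k.1 i j = (W k.1 * N).trace := by
    intro N
    simp only [Matrix.trace, Matrix.diag, Matrix.mul_apply]
    rw [Finset.sum_comm]
    refine Finset.sum_congr rfl fun j _ => Finset.sum_congr rfl fun i _ => ?_
    rw [(hW k.1).apply, mul_comm]
  have e3 : ∀ b' : Fin (K + 1) → ℝ, (W k.1 * cov W b').trace =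
      ∑ l, b' l * (W k.1 * W l).trace := fun b' => by
    simp only [cov, Finset.mul_sum, Matrix.trace_sum, Matrix.mul_smul, Matrix.trace_smul,
      smul_eq_mul]
  have h' : y ⬝ᵥ (W k.1).mulVec y - (W k.1 * cov W b).trace = 0 := by
    rw [← e1, ← e2, ← Finset.sum_sub_distrib]
    refine Eq.trans ?_ h
    refine Finset.sum_congr rfl fun i _ => ?_
    rw [← Finset.sum_sub_distrib]
    exact Finset.sum_congr rfl fun j _ => by rw [Matrix.sub_apply, sub_mul]
  have e4 : (W k.1 * cov W b).trace - (W k.1 * cov W β).trace =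
      ∑ l : Supp β, (b l.1 - β l.1) * (W k.1 * W l.1).trace := by
    rw [e3, e3, ← Finset.sum_sub_distrib]
    simp only [← sub_mul]
    -- Off the support `b` and `β` both vanish.
    rw [← Fintype.sum_subtype_add_sum_subtype (p := fun l => β l ≠ 0)
      (fun l => (b l - β l) * (W k.1 * W l).trace)]
    rw [add_eq_left]
    refine Finset.sum_eq_zero fun l _ => ?_
    have hl : β l.1 = 0 := not_not.1 l.2
    rw [hl, hb.1 l.1 hl]
    simp
  have e5 : (gramS W β).mulVec (fun k => b k.1 - β k.1) k =
      ∑ l : Supp β, (b l.1 - β l.1) * (W k.1 * W l.1).trace := by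
    simp only [Matrix.mulVec, dotProduct, gramS, Matrix.of_apply]
    exact Finset.sum_congr rfl fun l _ => mul_comm _ _
  rw [e5, ← e4]
  linarith

/-- The right-hand side of the normal equations, in terms of the noise. -/
lemma dotProduct_mulVec_sub_trace_eq (h : (cov W β).PosSemidef) (z : Fin p → ℝ) (k : Supp β) :
    (covSqrt W β).mulVec z ⬝ᵥ (W k.1).mulVec ((covSqrt W β).mulVec z) -
      (W k.1 * cov W β).trace = centeredQuad (sandwich W β k) z := by
  have h1 : (sandwich W β k).trace = (W k.1 * cov W β).trace := by
    rw [← covSqrt_mul_self h, sandwich, Matrix.mul_assoc, Matrix.trace_mul_comm, Matrix.mul_assoc]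
  rw [centeredQuad, h1, sandwich, ← Matrix.mulVec_mulVec, ← Matrix.mulVec_mulVec,
    Matrix.dotProduct_mulVec z, ← Matrix.mulVec_transpose, covSqrt_isSymm]

end Model

/-! ### Sub-Gaussian variables have uniformly bounded sixth moments -/

section Noise

/-- From `x⁶ ≤ 6! exp|x| ≤ 720 (exp x + exp(-x))` and the bound `exp(c/2)` for the moment generating
function at `±1`. The resulting constant depends on `c` alone. -/
lemma isNoiseLaw_map {Ω : Type*} [MeasurableSpace Ω] {P : Measure Ω} [IsProbabilityMeasure P]
    {X : Ω → ℝ} (hX : AEMeasurable X P) {c : ℝ≥0} (h : HasSubgaussianMGF X c P) {μ₄ : ℝ}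
    (h1 : ∫ ω, X ω ∂P = 0) (h2 : Var[X; P] = 1) (h4 : ∫ ω, X ω ^ 4 ∂P = μ₄) :
    IsNoiseLaw μ₄ (1440 * Real.exp (c / 2)) (P.map X) := by
  have hle : ∀ x : ℝ, x ^ 6 ≤ 720 * (Real.exp (1 * x) + Real.exp (-1 * x)) := fun x => by
    have h6 := Real.pow_div_factorial_le_exp |x| (abs_nonneg x) 6
    have e6 : |x| ^ 6 = x ^ 6 := by rw [← abs_pow, abs_of_nonneg (by positivity)]
    have hf : ((Nat.factorial 6 : ℕ) : ℝ) = 720 := by norm_num [Nat.factorial]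
    rw [e6, hf, div_le_iff₀ (by norm_num)] at h6
    have : Real.exp |x| ≤ Real.exp (1 * x) + Real.exp (-1 * x) := by
      rcases abs_cases x with ⟨hx, _⟩ | ⟨hx, _⟩ <;> rw [hx]
      · rw [one_mul]; linarith [Real.exp_pos (-1 * x)]
      · rw [neg_one_mul]; linarith [Real.exp_pos (1 * x)]
    linarith
  have hi : Integrable (fun ω => 720 * (Real.exp (1 * X ω) + Real.exp (-1 * X ω))) P :=
    ((h.integrable_exp_mul 1).add (h.integrable_exp_mul (-1))).const_mul _
  have hi6 : Integrable (fun ω => X ω ^ 6) P :=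
    hi.mono' (hX.pow_const 6).aestronglyMeasurable (ae_of_all _ fun ω => by
      rw [Real.norm_of_nonneg (by positivity)]; exact hle _)
  refine ⟨Measure.isProbabilityMeasure_map hX, ?_, ?_, ?_, ?_, ?_⟩
  · exact (integrable_map_measure (by fun_prop) hX).2 hi6
  · rw [integral_map hX (by fun_prop), h1]
  · rw [integral_map hX (by fun_prop), ← h2, variance_of_integral_eq_zero hX h1]
  · rw [integral_map hX (by fun_prop), h4]
  · rw [integral_map hX (by fun_prop)]
    refine (integral_mono hi6 hi fun ω => hle _).trans ?_
    have m1 := h.mgf_le 1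
    have m2 := h.mgf_le (-1)
    simp only [mgf, one_pow, mul_one, even_two, Even.neg_pow] at m1 m2
    have e := integral_add (h.integrable_exp_mul 1) (h.integrable_exp_mul (-1))
    rw [integral_const_mul, e]
    linarith

end Noise

/-! ### Asymptotic normality of linear functionals of the oracle error -/

section Oracle

variable {p K : ℕ} {W : Fin (K + 1) → Matrix (Fin p) (Fin p) ℝ} {β : Fin (K + 1) → ℝ}

/-- The error of the oracle estimator on the support, as a function of the noise. -/
noncomputable def oracleError (W : Fin (K + 1) → Matrix (Fin p) (Fin p) ℝ) (β : Fin (K + 1) → ℝ)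
    (z : Fin p → ℝ) : Supp β → ℝ :=
  (Gmat W β 0)⁻¹.mulVec ((p : ℝ)⁻¹ • fun k => centeredQuad (sandwich W β k) z)

lemma Gmat_mulVec_oracleError (h : IsUnit (Gmat W β 0).det) (z : Fin p → ℝ) :
    (Gmat W β 0).mulVec (oracleError W β z) =
      (p : ℝ)⁻¹ • fun k => centeredQuad (sandwich W β k) z := by
  rw [oracleError, Matrix.mulVec_mulVec, Matrix.mul_nonsing_inv _ h, Matrix.one_mulVec]

/-- An invertible Gram matrix determines the oracle estimate. The error thereby becomes a continuous
function of the noise, hence measurable. -/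
lemma IsOracle.sub_eq_oracleError {b : Fin (K + 1) → ℝ} {z : Fin p → ℝ} (hW : ∀ k, (W k).IsSymm)
    (hcov : (cov W β).PosSemidef) (h : IsUnit (Gmat W β 0).det)
    (hb : IsOracle W β ((covSqrt W β).mulVec z) b) :
    (fun k : Supp β => b k.1 - β k.1) = oracleError W β z := by
  have h1 := hb.gramS_mulVec hW
  simp only [dotProduct_mulVec_sub_trace_eq hcov] at h1
  rw [oracleError, ← h1, ← Matrix.smul_mulVec, ← Gmat_zero, Matrix.mulVec_mulVec,
    Matrix.nonsing_inv_mul _ h, Matrix.one_mulVec]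

lemma continuous_oracleError : Continuous (oracleError W β) := by
  unfold oracleError
  exact Continuous.matrix_mulVec continuous_const
    (continuous_pi fun k => continuous_const.mul (continuous_centeredQuad (sandwich W β k)))

variable {μ : Fin p → Measure ℝ} {μ₄ m : ℝ}

/-- The oracle error has second moment of order `(s + 1) / p`. -/
lemma integral_oracleError_sq_le (hμ : ∀ i, IsNoiseLaw μ₄ m (μ i)) (hW : ∀ k, (W k).IsSymm)
    (hp : 0 < p) {τ : ℝ} (hτ : 0 < τ) (hG : LeMinEig τ (Gmat W β 0)) {b : ℝ}
    (hB : ∀ k, OneNormLE (sandwich W β k) b) :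
    Integrable (fun z => oracleError W β z ⬝ᵥ oracleError W β z) (Measure.pi μ) ∧
    ∫ z, oracleError W β z ⬝ᵥ oracleError W β z ∂(Measure.pi μ) ≤
      τ⁻¹ ^ 2 * ((p : ℝ)⁻¹ * (Fintype.card (Supp β) * (18 * (1 + m) * b ^ 2))) := by
  have hp' : (0 : ℝ) < p := by exact_mod_cast hp
  have hle : ∀ z, oracleError W β z ⬝ᵥ oracleError W β z ≤
      τ⁻¹ ^ 2 * ((p : ℝ)⁻¹ ^ 2 * ∑ k, centeredQuad (sandwich W β k) z ^ 2) := fun z => by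
    refine (hG.dotProduct_self_le Gmat_zero_isSymm hτ _).trans_eq ?_
    rw [Gmat_mulVec_oracleError (hG.isUnit_det hτ)]
    simp only [dotProduct, ← sq, Pi.smul_apply, smul_eq_mul, mul_pow, ← Finset.mul_sum]
  have hi : ∀ k, Integrable (fun z => centeredQuad (sandwich W β k) z ^ 2) (Measure.pi μ) :=
    fun k => (memLp_centeredQuad hμ (sandwich_isSymm hW k)).integrable_sq
  have hint : Integrable (fun z => τ⁻¹ ^ 2 * ((p : ℝ)⁻¹ ^ 2 *
      ∑ k, centeredQuad (sandwich W β k) z ^ 2)) (Measure.pi μ) :=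
    ((integrable_finsetSum _ fun k _ => hi k).const_mul _).const_mul _
  have hint0 : Integrable (fun z => oracleError W β z ⬝ᵥ oracleError W β z) (Measure.pi μ) :=
    hint.mono' (Continuous.dotProduct continuous_oracleError
      continuous_oracleError).aestronglyMeasurable (ae_of_all _ fun z => by
        rw [Real.norm_of_nonneg (dotProduct_self_nonneg_real _)]; exact hle z)
  refine ⟨hint0, (integral_mono hint0 hint hle).trans ?_⟩
  rw [integral_const_mul, integral_const_mul, integral_finsetSum _ fun k _ => hi k]
  refine mul_le_mul_of_nonneg_left ?_ (by positivity)
  calc _ ≤ (p : ℝ)⁻¹ ^ 2 * ∑ _ : Supp β, (p : ℝ) * (18 * (1 + m) * b ^ 2) := by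
        refine mul_le_mul_of_nonneg_left (Finset.sum_le_sum fun k _ => ?_) (by positivity)
        simpa using integral_centeredQuad_sq_le hμ (sandwich_isSymm hW k) (hB k)
    _ = _ := by
        rw [Finset.sum_const, Finset.card_univ, nsmul_eq_mul]
        field_simp

lemma sum_abs_le_sqrt {ι : Type*} [Fintype ι] (a : ι → ℝ) :
    ∑ k, |a k| ≤ √(Fintype.card ι) * √(a ⬝ᵥ a) := by
  rw [← Real.sqrt_mul (Nat.cast_nonneg _)]
  refine Real.le_sqrt_of_sq_le ?_
  have := sq_sum_le_card_mul_sum_sq (s := Finset.univ) (f := fun k => |a k|)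
  simp only [sq_abs, Finset.card_univ] at this
  simpa only [dotProduct, ← sq] using this

/-- A quantitative form of the asymptotic normality of a linear functional of the oracle error. -/
theorem norm_integral_exp_oracleError_sub_le (hμ : ∀ i, IsNoiseLaw μ₄ m (μ i)) (hm : 0 ≤ m)
    (hW : ∀ k, (W k).IsSymm) (hcov : (cov W β).PosSemidef)
    (hp : 0 < p) {s : ℕ} (hs : Fintype.card (Supp β) = s + 1)
    {τ : ℝ} (hτ : 0 < τ) (hG : LeMinEig τ (Gmat W β 0)) {b : ℝ} (hb : 0 ≤ b)
    (hB : ∀ k, OneNormLE (sandwich W β k) b) (G₀ : Matrix (Supp β) (Supp β) ℝ)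
    (a : Supp β → ℝ) {d : ℝ} (hd : 0 ≤ d) (ha : √(a ⬝ᵥ a) ≤ d) {v : ℝ}
    (hv : v = ((s : ℝ) + 1)⁻¹ * (a ⬝ᵥ ((2 : ℝ) • Gmat W β 1 + (μ₄ - 3) • Hmat W β).mulVec a)) :
    ‖(∫ z, Complex.exp ((√((p : ℝ) / ((s : ℝ) + 1)) * (a ⬝ᵥ G₀.mulVec (oracleError W β z)) : ℝ) *
        Complex.I) ∂(Measure.pi μ)) - Complex.exp (-(v / 2 : ℝ))‖ ≤
      √(frobNorm (Gmat W β 0 - G₀) ^ 2 * (d ^ 2 * (τ⁻¹ ^ 2 * (18 * (1 + m) * b ^ 2)))) +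
      (p * ((9 * (1 + m)) * (18 * (1 + m) * (d * b / √p) ^ 3)) +
        √(p * (162 * (1 + m) ^ 2 * (d * b / √p) ^ 4))) * Real.exp |v| := by
  have := fun i => (hμ i).isProbabilityMeasure
  have hp' : (0 : ℝ) < p := by exact_mod_cast hp
  have hs' : (0 : ℝ) < (s : ℝ) + 1 := by positivity
  have hcard : ((Fintype.card (Supp β) : ℕ) : ℝ) = s + 1 := by rw [hs]; push_cast; rfl
  set r := √((p : ℝ) / ((s : ℝ) + 1)) with hr
  have hr2 : r ^ 2 = p / (s + 1) := Real.sq_sqrt (by positivity)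
  have hr0 : 0 ≤ r := Real.sqrt_nonneg _
  set c : Supp β → ℝ := (r * (p : ℝ)⁻¹) • a with hc
  set M := ∑ k, c k • sandwich W β k with hM
  let ρ : (Fin p → ℝ) → ℝ := fun z => r * (a ⬝ᵥ (G₀ - Gmat W β 0).mulVec (oracleError W β z))
  have hMs : M.IsSymm := by
    rw [Matrix.IsSymm, hM, Matrix.transpose_sum]
    exact Finset.sum_congr rfl fun k _ => by rw [Matrix.transpose_smul, sandwich_isSymm hW]
  -- Cauchy-Schwarz costs `√(s+1)`, which the normalization `r` cancels; this leaves the order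
  -- `p^{-1/2}`.
  have hsum : ∑ k, |c k| ≤ d / √p := by
    have h1 : ∑ k, |c k| = (r * (p : ℝ)⁻¹) * ∑ k, |a k| := by
      simp only [hc, Pi.smul_apply, smul_eq_mul, abs_mul, abs_of_nonneg hr0,
        abs_of_pos (inv_pos.2 hp'), Finset.mul_sum]
    have h2 : (r * (p : ℝ)⁻¹) * √((s : ℝ) + 1) = 1 / √p := by
      rw [hr, Real.sqrt_div hp'.le]
      have : √((s : ℝ) + 1) ≠ 0 := (Real.sqrt_pos.2 hs').ne'
      have h3 : √(p : ℝ) ≠ 0 := (Real.sqrt_pos.2 hp').ne'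
      field_simp
      exact Real.sq_sqrt hp'.le
    rw [h1]
    calc _ ≤ (r * (p : ℝ)⁻¹) * (√((s : ℝ) + 1) * d) := by
          refine mul_le_mul_of_nonneg_left ((sum_abs_le_sqrt a).trans ?_) (by positivity)
          rw [hcard]
          exact mul_le_mul_of_nonneg_left ha (Real.sqrt_nonneg _)
      _ = _ := by rw [← mul_assoc, h2]; ring
  have hMκ : OneNormLE M (d * b / √p) := fun j =>
    (oneNormLE_sum_smul hB c j).trans ((mul_le_mul_of_nonneg_right hsum hb).trans_eq (by ring))
  have hMv : quadVar μ₄ M = v := by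
    rw [hM, quadVar_sum_smul_sandwich hcov hp'.ne', hc, Matrix.mulVec_smul, smul_dotProduct,
      dotProduct_smul, smul_eq_mul, smul_eq_mul, hv]
    have : (p : ℝ) * (r * (p : ℝ)⁻¹ * (r * (p : ℝ)⁻¹)) = ((s : ℝ) + 1)⁻¹ := by
      calc _ = r ^ 2 * (p : ℝ)⁻¹ := by field_simp
        _ = _ := by rw [hr2]; field_simp
    rw [← this]
    ring
  -- With `G_{0,p}` in place of `G₀` the functional would be exactly a quadratic form; `ρ` is the
  -- price of the replacement.
  have hdec : ∀ z, r * (a ⬝ᵥ G₀.mulVec (oracleError W β z)) = centeredQuad M z + ρ z := fun z => by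
    have h1 : centeredQuad M z = r * (a ⬝ᵥ (Gmat W β 0).mulVec (oracleError W β z)) := by
      rw [Gmat_mulVec_oracleError (hG.isUnit_det hτ), hM, centeredQuad_sum_smul, hc,
        smul_dotProduct, dotProduct_smul, smul_eq_mul, smul_eq_mul]
      ring
    simp only [ρ]
    rw [h1, Matrix.sub_mulVec, dotProduct_sub]
    ring
  have cρ : Continuous ρ := continuous_const.mul (Continuous.dotProduct continuous_const
    (Continuous.matrix_mulVec continuous_const continuous_oracleError))
  obtain ⟨hint, hle⟩ := integral_oracleError_sq_le (β := β) hμ hW hp hτ hG hB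
  have hfr : frobNorm (G₀ - Gmat W β 0) = frobNorm (Gmat W β 0 - G₀) := by
    simp only [frobNorm, Matrix.sub_apply]
    congr 1
    exact Finset.sum_congr rfl fun i _ => Finset.sum_congr rfl fun j _ => by ring
  set F := frobNorm (Gmat W β 0 - G₀) with hF
  have hF0 : 0 ≤ F := frobNorm_nonneg _
  have hρ : ∀ z, ρ z ^ 2 ≤ r ^ 2 * (F ^ 2 * (d ^ 2 * (oracleError W β z ⬝ᵥ oracleError W β z))) :=
    fun z => by
      simp only [ρ]
      rw [mul_pow]
      refine mul_le_mul_of_nonneg_left ?_ (sq_nonneg r)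
      have h1 := abs_dotProduct_mulVec_le (G₀ - Gmat W β 0) a (oracleError W β z)
      rw [hfr] at h1
      rw [← sq_abs]
      calc _ ≤ (F * (√(a ⬝ᵥ a) * √(oracleError W β z ⬝ᵥ oracleError W β z))) ^ 2 :=
            pow_le_pow_left₀ (abs_nonneg _) h1 2
        _ ≤ (F * (d * √(oracleError W β z ⬝ᵥ oracleError W β z))) ^ 2 := by gcongr
        _ = _ := by rw [mul_pow, mul_pow, Real.sq_sqrt (dotProduct_self_nonneg_real _)]
  have hint2 : Integrable (fun z => r ^ 2 * (F ^ 2 * (d ^ 2 * (oracleError W β z ⬝ᵥ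
      oracleError W β z)))) (Measure.pi μ) := ((hint.const_mul _).const_mul _).const_mul _
  have hρL : MemLp ρ 2 (Measure.pi μ) :=
    (memLp_two_iff_integrable_sq cρ.aestronglyMeasurable).2 (hint2.mono'
      (cρ.pow 2).aestronglyMeasurable (ae_of_all _ fun z => by
        rw [Real.norm_of_nonneg (sq_nonneg _)]; exact hρ z))
  -- The factor `r² = p/(s+1)` cancels the order `(s+1)/p` of the second moment of the oracle error.
  have hρ2 : ∫ z, ρ z ^ 2 ∂(Measure.pi μ) ≤ F ^ 2 * (d ^ 2 * (τ⁻¹ ^ 2 * (18 * (1 + m) * b ^ 2))) := by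
    refine (integral_mono hρL.integrable_sq hint2 hρ).trans ?_
    rw [integral_const_mul, integral_const_mul, integral_const_mul]
    calc _ ≤ r ^ 2 * (F ^ 2 * (d ^ 2 * (τ⁻¹ ^ 2 * ((p : ℝ)⁻¹ *
          (Fintype.card (Supp β) * (18 * (1 + m) * b ^ 2)))))) := by gcongr
      _ = _ := by rw [hr2, hcard]; field_simp
  have hρ1 := integral_abs_le_sqrt hρL hρ2
  have cQ : Continuous (centeredQuad M) := continuous_centeredQuad M
  have c1 : Continuous fun z => Complex.exp ((centeredQuad M z : ℝ) * Complex.I) := by fun_prop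
  have c2 : Continuous fun z => Complex.exp ((centeredQuad M z + ρ z : ℝ) * Complex.I) := by fun_prop
  have i1 : Integrable (fun z => Complex.exp ((centeredQuad M z : ℝ) * Complex.I))
      (Measure.pi μ) := (integrable_const (1 : ℝ)).mono' c1.aestronglyMeasurable
        (ae_of_all _ fun z => (Complex.norm_exp_ofReal_mul_I _).le)
  have i2 : Integrable (fun z => Complex.exp ((centeredQuad M z + ρ z : ℝ) * Complex.I))
      (Measure.pi μ) := (integrable_const (1 : ℝ)).mono' c2.aestronglyMeasurable
        (ae_of_all _ fun z => (Complex.norm_exp_ofReal_mul_I _).le)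
  have hdiff : ‖(∫ z, Complex.exp ((centeredQuad M z + ρ z : ℝ) * Complex.I) ∂(Measure.pi μ)) -
      ∫ z, Complex.exp ((centeredQuad M z : ℝ) * Complex.I) ∂(Measure.pi μ)‖ ≤
      ∫ z, |ρ z| ∂(Measure.pi μ) := by
    rw [← integral_sub i2 i1]
    refine norm_integral_le_of_norm_le (hρL.integrable (by norm_num)).abs (ae_of_all _ fun z => ?_)
    have e : Complex.exp ((centeredQuad M z + ρ z : ℝ) * Complex.I) -
        Complex.exp ((centeredQuad M z : ℝ) * Complex.I) =
        Complex.exp ((centeredQuad M z : ℝ) * Complex.I) *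
          (Complex.exp ((ρ z : ℝ) * Complex.I) - 1) := by
      rw [mul_sub, mul_one, ← Complex.exp_add]
      push_cast
      ring_nf
    rw [e, norm_mul, Complex.norm_exp_ofReal_mul_I, one_mul]
    exact norm_exp_mul_I_sub_one_le _
  have hclt := norm_charFun_centeredQuad_sub_le hμ hMs hMκ (by positivity) hm
  rw [hMv, Fintype.card_fin] at hclt
  simp only [hdec]
  refine (norm_sub_le_norm_sub_add_norm_sub _
    (∫ z, Complex.exp ((centeredQuad M z : ℝ) * Complex.I) ∂(Measure.pi μ)) _).trans ?_
  exact add_le_add (hdiff.trans hρ1) hclt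

end Oracle

/-! ### Vanishing of the error terms -/

section Limit

lemma tendsto_mul_dotProduct_mulVec_of_frobNorm {ι : ℕ → Type*} [∀ n, Fintype (ι n)]
    {E : ∀ n, Matrix (ι n) (ι n) ℝ} (hE : Tendsto (fun n => frobNorm (E n)) atTop (𝓝 0))
    {a : ∀ n, ι n → ℝ} {d : ℝ} (hd : 0 ≤ d) (ha : ∀ n, √(a n ⬝ᵥ a n) ≤ d) {q : ℕ → ℝ}
    (hq0 : ∀ n, 0 ≤ q n) (hq1 : ∀ n, q n ≤ 1) :
    Tendsto (fun n => q n * (a n ⬝ᵥ (E n).mulVec (a n))) atTop (𝓝 0) := by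
  have h : Tendsto (fun n => frobNorm (E n) * (d * d)) atTop (𝓝 0) := by
    simpa using hE.mul_const (d * d)
  refine squeeze_zero_norm (fun n => ?_) h
  rw [Real.norm_eq_abs, abs_mul, abs_of_nonneg (hq0 n)]
  refine (mul_le_of_le_one_left (abs_nonneg _) (hq1 n)).trans
    ((abs_dotProduct_mulVec_le _ _ _).trans ?_)
  have := ha n
  have := frobNorm_nonneg (E n)
  gcongr

/-- Column sums of order `p^{-1/2}` make both terms of order `p^{-1/2}`. -/
lemma tendsto_clt_error {p : ℕ → ℕ} (hp : Tendsto p atTop atTop) (A B k : ℝ) :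
    Tendsto (fun n => (p n : ℝ) * (A * (B * (k / √(p n)) ^ 3)) +
      √(p n * (162 * A ^ 2 * (k / √(p n)) ^ 4))) atTop (𝓝 0) := by
  have h1 : Tendsto (fun n => (√(p n : ℝ))⁻¹) atTop (𝓝 0) :=
    (Real.tendsto_sqrt_atTop.comp (tendsto_natCast_atTop_atTop.comp hp)).inv_tendsto_atTop
  have h2 : Tendsto (fun n => A * B * k ^ 3 * (√(p n : ℝ))⁻¹ +
      √(162 * A ^ 2 * k ^ 4 * (√(p n : ℝ))⁻¹ ^ 2)) atTop (𝓝 0) := by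
    have h3 := (h1.const_mul (A * B * k ^ 3)).add
      (((h1.pow 2).const_mul (162 * A ^ 2 * k ^ 4)).sqrt)
    simpa using h3
  refine h2.congr' ?_
  filter_upwards [hp.eventually_gt_atTop 0] with n hn
  have hp' : (0 : ℝ) < p n := by exact_mod_cast hn
  have hs : (0 : ℝ) < √(p n) := Real.sqrt_pos.2 hp'
  have hsq : (p n : ℝ) = √(p n) ^ 2 := (Real.sq_sqrt hp'.le).symm
  have e1 : A * B * k ^ 3 * (√(p n : ℝ))⁻¹ = (p n : ℝ) * (A * (B * (k / √(p n)) ^ 3)) := by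
    nth_rewrite 2 [hsq]
    field_simp
  have e2 : 162 * A ^ 2 * k ^ 4 * (√(p n : ℝ))⁻¹ ^ 2 =
      p n * (162 * A ^ 2 * (k / √(p n)) ^ 4) := by
    nth_rewrite 2 [hsq]
    field_simp
  rw [e1, e2]

end Limit

end SCR

/-! ### Proof of the limit theorem -/

theorem theorem3
    -- the `n`-th model: dimension `p n`, similarity matrices `W n 0 = I, W n 1, …, W n (K n)`,
    -- true coefficients `β n` with `s n + 1` nonzero entries
    (p K s : ℕ → ℕ) (hp : Tendsto p atTop atTop)
    (W : ∀ n, Fin (K n + 1) → Matrix (Fin (p n)) (Fin (p n)) ℝ)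
    (hW0 : ∀ n, W n 0 = 1)
    (hWsymm : ∀ n k, (W n k).IsSymm)
    (β : ∀ n, Fin (K n + 1) → ℝ)
    (hs : ∀ n, Fintype.card (SCR.Supp (β n)) = s n + 1)
    -- the noise variables, the response and the oracle estimator
    {Ω : ℕ → Type*} [∀ n, MeasurableSpace (Ω n)]
    (P : ∀ n, Measure (Ω n)) [∀ n, IsProbabilityMeasure (P n)]
    (Z : ∀ n, Fin (p n) → Ω n → ℝ)
    (y : ∀ n, Ω n → Fin (p n) → ℝ)
    (βhat : ∀ n, Ω n → Fin (K n + 1) → ℝ)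
    (horacle : ∀ n ω, SCR.IsOracle (W n) (β n) (y n ω) (βhat n ω))
    -- (C2) minimal eigenvalue
    (τmin : ℝ) (hτmin : 0 < τmin)
    (hC2 : ∀ n, SCR.LeMinEig τmin ((p n : ℝ)⁻¹ • SCR.gramS (W n) (β n)))
    -- (C3) sub-Gaussian distribution
    (hy : ∀ n ω, y n ω = (SCR.covSqrt (W n) (β n)).mulVec (fun j => Z n j ω))
    (hindep : ∀ n, iIndepFun (Z n) (P n))
    (hident : ∀ n i j, IdentDistrib (Z n i) (Z n j) (P n) (P n))
    (hmean : ∀ n j, ∫ ω, Z n j ω ∂(P n) = 0)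
    (c : ℝ≥0) (hc : 0 < c)
    (hsubG : ∀ n j, HasSubgaussianMGF (Z n j) (c ^ 2) (P n))
    (hvar : ∀ n j, Var[Z n j; P n] = 1)
    (μ₄ : ℝ) (hμ₄ : ∀ n j, ∫ ω, Z n j ω ^ 4 ∂(P n) = μ₄)
    (σmin : ℝ) (hσmin : 0 < σmin)
    (hC3 : ∀ n, SCR.LeMinEig σmin (SCR.cov (W n) (β n)))
    -- (C4) bounded ℓ₁-norm
    (w : ℝ) (hw : ∀ n k, SCR.OneNormLE (W n k) w)
    (σmax : ℝ) (hσmax : 0 < σmax)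
    (hC4 : ∀ n, SCR.OneNormLE (SCR.covSqrt (W n) (β n)) (√σmax))
    -- (C6) convergence
    (G₀ G₁ H : ∀ n, Matrix (SCR.Supp (β n)) (SCR.Supp (β n)) ℝ)
    (τ₀ : ℝ) (hτ₀ : 0 < τ₀)
    (hG₀pos : ∀ n, (G₀ n).PosDef) (hG₀min : ∀ n, SCR.LeMinEig τ₀ (G₀ n))
    (hG₁pos : ∀ n, (G₁ n).PosDef) (hG₁min : ∀ n, SCR.LeMinEig τ₀ (G₁ n))
    (hG₀ : Tendsto (fun n => SCR.frobNorm (SCR.Gmat (W n) (β n) 0 - G₀ n)) atTop (𝓝 0))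
    (hG₁ : Tendsto (fun n => SCR.frobNorm (SCR.Gmat (W n) (β n) 1 - G₁ n)) atTop (𝓝 0))
    (hH : Tendsto (fun n => SCR.frobNorm (SCR.Hmat (W n) (β n) - H n)) atTop (𝓝 0))
    -- the projection matrix `A` and the limiting covariance matrix `C`
    (L : ℕ) (hL : 0 < L)
    (A : ∀ n, Matrix (Fin L) (SCR.Supp (β n)) ℝ)
    (hA : ∃ a : ℝ, ∀ n, SCR.opNorm (A n) ≤ a)
    (C : Matrix (Fin L) (Fin L) ℝ) (hCpos : C.PosDef)
    (hC : Tendsto (fun n => ((s n : ℝ) + 1)⁻¹ •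
        (A n * ((2 : ℝ) • G₁ n + (μ₄ - 3) • H n) * (A n).transpose)) atTop (𝓝 C)) :
    TendstoInDistribution
      (fun n ω => WithLp.toLp 2 (√((p n : ℝ) / ((s n : ℝ) + 1)) •
        (A n * G₀ n).mulVec (fun k : SCR.Supp (β n) => βhat n ω k.1 - β n k.1)))
      atTop (id : EuclideanSpace ℝ (Fin L) → EuclideanSpace ℝ (Fin L)) P
      (multivariateGaussian 0 C) := by
  have hcov : ∀ n, (SCR.cov (W n) (β n)).PosSemidef := fun n =>
    (hC3 n).posSemidef (SCR.cov_isSymm (hWsymm n) _) hσmin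
  have hG : ∀ n, SCR.LeMinEig τmin (SCR.Gmat (W n) (β n) 0) := fun n => by
    rw [SCR.Gmat_zero]; exact hC2 n
  have hdet := fun n => (hG n).isUnit_det hτmin
  -- In dimension zero the Gram matrix would vanish, although it is invertible and the support is
  -- nonempty.
  have hp0 : ∀ n, 0 < p n := fun n => by
    rw [Nat.pos_iff_ne_zero]
    intro h0
    have hne : Nonempty (SCR.Supp (β n)) := Fintype.card_pos_iff.1 (by rw [hs n]; omega)
    have hz : SCR.Gmat (W n) (β n) 0 = 0 := by
      have hpinv : (p n : ℝ)⁻¹ = 0 := by rw [h0]; simp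
      rw [SCR.Gmat_zero, hpinv, zero_smul]
    have hu := hdet n
    rw [hz, Matrix.det_zero] at hu
    exact not_isUnit_zero hu
  have hw0 : 0 ≤ w := (Finset.sum_nonneg fun i _ => abs_nonneg _).trans (hw 0 0 ⟨0, hp0 0⟩)
  have hZ : ∀ n j, AEMeasurable (Z n j) (P n) := fun n j => (hident n j j).aemeasurable_fst
  set m := 1440 * Real.exp (((c ^ 2 : ℝ≥0) : ℝ) / 2) with hm
  have hm0 : 0 ≤ m := by positivity
  let μ : ∀ n, Fin (p n) → Measure ℝ := fun n j => (P n).map (Z n j)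
  have hμ : ∀ n j, SCR.IsNoiseLaw μ₄ m (μ n j) := fun n j =>
    SCR.isNoiseLaw_map (hZ n j) (hsubG n j) (hmean n j) (hvar n j) (hμ₄ n j)
  have hmap : ∀ n, (P n).map (fun ω j => Z n j ω) = Measure.pi (μ n) := fun n =>
    (iIndepFun_iff_map_fun_eq_pi_map (hZ n)).1 (hindep n)
  let f : ∀ n, (Fin (p n) → ℝ) → EuclideanSpace ℝ (Fin L) := fun n z =>
    WithLp.toLp 2 (√((p n : ℝ) / ((s n : ℝ) + 1)) •
      (A n * G₀ n).mulVec (SCR.oracleError (W n) (β n) z))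
  have hf : ∀ n, Continuous (f n) := fun n => by
    refine (PiLp.continuous_toLp 2 _).comp (continuous_pi fun i => continuous_const.mul ?_)
    exact (continuous_apply i).comp
      (Continuous.matrix_mulVec continuous_const SCR.continuous_oracleError)
  have hYf : ∀ n, (fun ω => WithLp.toLp 2 (√((p n : ℝ) / ((s n : ℝ) + 1)) •
      (A n * G₀ n).mulVec (fun k : SCR.Supp (β n) => βhat n ω k.1 - β n k.1))) =
      fun ω => f n (fun j => Z n j ω) := fun n => by
    ext1 ω
    have h := horacle n ω
    rw [hy] at h
    rw [h.sub_eq_oracleError (hWsymm n) (hcov n) (hdet n)]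
  have hZv : ∀ n, AEMeasurable (fun ω j => Z n j ω) (P n) := fun n =>
    aemeasurable_pi_iff.2 (hZ n)
  have hYmeas : ∀ n, AEMeasurable (fun ω => WithLp.toLp 2 (√((p n : ℝ) / ((s n : ℝ) + 1)) •
      (A n * G₀ n).mulVec (fun k : SCR.Supp (β n) => βhat n ω k.1 - β n k.1))) (P n) := fun n => by
    rw [hYf]; exact (hf n).measurable.comp_aemeasurable (hZv n)
  refine ⟨hYmeas, by fun_prop, ?_⟩
  -- Lévy's continuity theorem reduces the claim to one direction `u` at a time.
  refine ProbabilityMeasure.tendsto_iff_tendsto_charFun.2 fun u => ?_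
  obtain ⟨α, hα⟩ := hA
  set a : ∀ n, SCR.Supp (β n) → ℝ := fun n => Matrix.vecMul u.ofLp (A n) with ha
  set d := |α| * √(u.ofLp ⬝ᵥ u.ofLp) with hd
  have hd0 : 0 ≤ d := by positivity
  have had : ∀ n, √(a n ⬝ᵥ a n) ≤ d := fun n => by
    refine Real.sqrt_le_iff.2 ⟨hd0, (SCR.vecMul_dotProduct_self_le (A n) u.ofLp).trans ?_⟩
    rw [hd, mul_pow, Real.sq_sqrt (SCR.dotProduct_self_nonneg_real _)]
    have h0 : 0 ≤ SCR.opNorm (A n) := by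
      open scoped Matrix.Norms.L2Operator in exact norm_nonneg (A n)
    have := (hα n).trans (le_abs_self α)
    have := SCR.dotProduct_self_nonneg_real u.ofLp
    gcongr
  set q : ℕ → ℝ := fun n => ((s n : ℝ) + 1)⁻¹ with hq
  have hq0 : ∀ n, 0 ≤ q n := fun n => by positivity
  have hq1 : ∀ n, q n ≤ 1 := fun n =>
    inv_le_one_of_one_le₀ (by linarith [Nat.cast_nonneg (α := ℝ) (s n)])
  set v : ℕ → ℝ := fun n => q n * (a n ⬝ᵥ ((2 : ℝ) • SCR.Gmat (W n) (β n) 1 +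
    (μ₄ - 3) • SCR.Hmat (W n) (β n)).mulVec (a n)) with hv
  -- `G₁` and `H` may be exchanged for their finite-`p` versions: the vectors `a n` are bounded, `q
  -- n ≤ 1`, and Frobenius convergence controls the quadratic forms even as the index sets grow.
  have hvlim : Tendsto v atTop (𝓝 (u.ofLp ⬝ᵥ C.mulVec u.ofLp)) := by
    have h1 : Tendsto (fun n => u.ofLp ⬝ᵥ (((s n : ℝ) + 1)⁻¹ • (A n * ((2 : ℝ) • G₁ n +
        (μ₄ - 3) • H n) * (A n).transpose)).mulVec u.ofLp) atTop
        (𝓝 (u.ofLp ⬝ᵥ C.mulVec u.ofLp)) := by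
      have hc : Continuous fun M : Matrix (Fin L) (Fin L) ℝ => u.ofLp ⬝ᵥ M.mulVec u.ofLp :=
        Continuous.dotProduct continuous_const
          (Continuous.matrix_mulVec continuous_id continuous_const)
      exact (hc.tendsto C).comp hC
    have h2 := SCR.tendsto_mul_dotProduct_mulVec_of_frobNorm hG₁ hd0 had hq0 hq1
    have h3 := SCR.tendsto_mul_dotProduct_mulVec_of_frobNorm hH hd0 had hq0 hq1
    have h4 := (h1.add (h2.const_mul 2)).add (h3.const_mul (μ₄ - 3))
    simp only [mul_zero, add_zero] at h4
    refine h4.congr fun n => ?_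
    have e : u.ofLp ⬝ᵥ (((s n : ℝ) + 1)⁻¹ • (A n * ((2 : ℝ) • G₁ n +
        (μ₄ - 3) • H n) * (A n).transpose)).mulVec u.ofLp =
        q n * (a n ⬝ᵥ ((2 : ℝ) • G₁ n + (μ₄ - 3) • H n).mulVec (a n)) := by
      rw [Matrix.smul_mulVec, dotProduct_smul, smul_eq_mul, ← Matrix.mulVec_mulVec,
        ← Matrix.mulVec_mulVec, Matrix.dotProduct_mulVec, Matrix.mulVec_transpose]
    rw [e]
    simp only [hv, Matrix.add_mulVec, Matrix.sub_mulVec, Matrix.smul_mulVec, dotProduct_add,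
      dotProduct_sub, dotProduct_smul, smul_eq_mul]
    ring
  have hchar : ∀ n, charFun ((P n).map (fun ω => WithLp.toLp 2 (√((p n : ℝ) / ((s n : ℝ) + 1)) •
      (A n * G₀ n).mulVec (fun k : SCR.Supp (β n) => βhat n ω k.1 - β n k.1)))) u =
      ∫ z, Complex.exp ((√((p n : ℝ) / ((s n : ℝ) + 1)) *
        (a n ⬝ᵥ (G₀ n).mulVec (SCR.oracleError (W n) (β n) z)) : ℝ) * Complex.I)
        ∂(Measure.pi (μ n)) := fun n => by
    rw [hYf n, charFun_apply, ← hmap n, integral_map (hZv n), integral_map]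
    · refine integral_congr_ae (ae_of_all _ fun ω => ?_)
      simp only [f]
      congr 3
      rw [EuclideanSpace.inner_eq_star_dotProduct]
      simp only [star_trivial, dotProduct_smul, smul_eq_mul]
      rw [← Matrix.mulVec_mulVec, Matrix.dotProduct_mulVec]
    · exact (hf n).measurable.comp_aemeasurable (hZv n)
    · exact Continuous.aestronglyMeasurable (by fun_prop)
    · refine Continuous.aestronglyMeasurable ?_
      have h1 : Continuous fun z => √((p n : ℝ) / ((s n : ℝ) + 1)) *
          (a n ⬝ᵥ (G₀ n).mulVec (SCR.oracleError (W n) (β n) z)) :=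
        continuous_const.mul (Continuous.dotProduct continuous_const
          (Continuous.matrix_mulVec continuous_const SCR.continuous_oracleError))
      fun_prop
  have hbound := fun n => SCR.norm_integral_exp_oracleError_sub_le (hμ n) hm0 (hWsymm n) (hcov n)
    (hp0 n) (hs n) hτmin (hG n) (b := σmax * w) (by positivity)
    (SCR.oneNormLE_sandwich hσmax.le hw0 (hw n) (hC4 n)) (G₀ n) (a n) hd0 (had n) (v := v n) rfl
  have herr : Tendsto (fun n => √(SCR.frobNorm (SCR.Gmat (W n) (β n) 0 - G₀ n) ^ 2 *
      (d ^ 2 * (τmin⁻¹ ^ 2 * (18 * (1 + m) * (σmax * w) ^ 2)))) +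
      (p n * ((9 * (1 + m)) * (18 * (1 + m) * (d * (σmax * w) / √(p n)) ^ 3)) +
        √(p n * (162 * (1 + m) ^ 2 * (d * (σmax * w) / √(p n)) ^ 4))) * Real.exp |v n|)
      atTop (𝓝 0) := by
    -- The factor `exp |v n|` converges along with `v n`, so it cannot spoil the decay.
    have h1 := ((hG₀.pow 2).mul_const (d ^ 2 * (τmin⁻¹ ^ 2 * (18 * (1 + m) * (σmax * w) ^ 2)))).sqrt
    have h2 := SCR.tendsto_clt_error hp (1 + m) (9 * (18 * (1 + m))) (d * (σmax * w))
    have h3 := h1.add (h2.mul ((Real.continuous_exp.tendsto _).comp hvlim.abs))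
    simp only [ne_eq, OfNat.ofNat_ne_zero, not_false_eq_true, zero_pow, zero_mul, Real.sqrt_zero,
      add_zero] at h3
    refine h3.congr fun n => ?_
    simp only [Function.comp_apply]
    ring_nf
  have hexp : Tendsto (fun n => Complex.exp (-(v n / 2 : ℝ))) atTop
      (𝓝 (Complex.exp (-((u.ofLp ⬝ᵥ C.mulVec u.ofLp) / 2 : ℝ)))) := by
    have hc : Continuous fun x : ℝ => Complex.exp (-(x / 2 : ℝ)) := by fun_prop
    exact (hc.tendsto _).comp hvlim
  have hlim : charFun ((multivariateGaussian 0 C).map (id : EuclideanSpace ℝ (Fin L) → _)) u =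
      Complex.exp (-((u.ofLp ⬝ᵥ C.mulVec u.ofLp) / 2 : ℝ)) := by
    rw [Measure.map_id, charFun_multivariateGaussian hCpos.posSemidef]
    simp
  simp only [ProbabilityMeasure.coe_mk]
  rw [hlim]
  have hz := (squeeze_zero_norm hbound herr).add hexp
  simp only [sub_add_cancel, zero_add] at hz
  exact hz.congr fun n => (hchar n).symm
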